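/- Let $E$ be a smooth connected projective curve of genus $1$ over $\mathbb{C}$, and let $$0 \to \mathcal{O}_E \to \mathcal{V} \xrightarrow{\ \pi\ } \mathcal{O}_E \to 0$$ be a nonsplit extension (so $\mathcal{V}$ is the rank $2$ Atiyah bundle). Let $\varsigma : S = \mathrm{Proj}_E\,\mathrm{Sym}\,\mathcal{V} \to E$ be the corresponding ruled surface, and let $E_\infty \subset S$ be the distinguished section, i.e. the image of the section of $\varsigma$ corresponding to the quotient $\pi : \mathcal{V} \to \mathcal{O}_E$ (equivalently, the locus where the subsheaf $\mathcal{O}_E \subset \mathcal{V}$ vanishes). Let $C$ be a smooth connected projective curve over $\mathbb{C}$, let $r \in C(\mathbb{C})$, and let $f : C \to E$ be a nonconstant morphism. The trace map $\mathrm{Tr} : \Gamma(\Omega_C) \to \Gamma(\Omega_E)$ is the Serre dual of the pullback map $f^* : H^1(E, \mathcal{O}_E) \to H^1(C, \mathcal{O}_C)$. If there is a morphism $\widetilde f : C \to S$ such that $\varsigma \circ \widetilde f = f$ and $\widetilde f^{-1}(E_\infty) = \{r\}$ scheme-theoretically (that is, $\widetilde f^{-1}(E_\infty)$ is the reduced point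 $r$), then $f$ is quasi-traceless relative to $r$: $\mathrm{Tr}(\eta) = 0$ for every regular $1$-form $\eta \in \Gamma(\Omega_C)$ with $\eta(r) = 0$. -/

import Mathlib

open CategoryTheory AlgebraicGeometry

noncomputable section

/-! ## Smooth projective curves over `ℂ` -/

/-- A smooth connected projective curve over `ℂ`: an integral scheme, smooth of relative dimension
one and proper over `ℂ`.  (Over `ℂ` a smooth connected scheme is integral, and a proper curve is
projective.) -/
structure SmoothProjectiveCurve where
  /-- the underlying scheme -/
  X : Scheme.{0}
  /-- the structure morphism -/
  str : X ⟶ Spec (.of ℂ)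
  [isIntegral : IsIntegral X]
  [smooth : SmoothOfRelativeDimension 1 str]
  [proper : IsProper str]

namespace SmoothProjectiveCurve

attribute [instance] isIntegral smooth proper

variable (C E : SmoothProjectiveCurve)

/-- The closed points of a curve; they are the same as its `ℂ`-points. -/
def Point : Type := {x : C.X // IsClosed ({x} : Set C.X)}

/-! ### Topology: every point except the generic one is closed -/

theorem prime_eq_of_etale {A B : Type*} [CommRing A] [CommRing B] [IsDomain B] [Algebra A B]
    [Algebra.Etale A B] [IsDomain A] [Ring.DimensionLEOne A] (P P' : Ideal B) [P.IsPrime]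
    [P'.IsPrime] (hP : P ≠ ⊥) (hle : P ≤ P') : P = P' := by
  apply Algebra.QuasiFinite.eq_of_le_of_under_eq (R := A) P P' hle
  have h0 : P.under A ≠ ⊥ := by
    intro h
    apply hP
    have : (⊥ : Ideal B).IsPrime := Ideal.isPrime_bot
    refine (Algebra.QuasiFinite.eq_of_le_of_under_eq (R := A) ⊥ P bot_le ?_).symm
    rw [h]
    exact le_bot_iff.mp ((Ideal.comap_mono bot_le).trans h.le)
  exact (Ring.DimensionLEOne.maximalOfPrime h0 inferInstance).eq_of_le
    (Ideal.IsPrime.ne_top inferInstance) (Ideal.comap_mono hle)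

theorem prime_eq_of_standardSmooth {R B : Type} [CommRing R] (hR : IsField R) [CommRing B]
    [IsDomain B] {φ : R →+* B} (hφ : φ.IsStandardSmoothOfRelativeDimension 1)
    (P P' : Ideal B) [P.IsPrime] [P'.IsPrime] (hP : P ≠ ⊥) (hle : P ≤ P') : P = P' := by
  let := hR.toField
  obtain ⟨g, -, hg⟩ := hφ.exists_etale_mvPolynomial
  let := g.toAlgebra
  have : Algebra.Etale (MvPolynomial (Fin 1) R) B := hg
  have : IsPrincipalIdealRing (MvPolynomial (Fin 1) R) :=
    IsPrincipalIdealRing.of_surjective (MvPolynomial.uniqueAlgEquiv R (Fin 1)).symm.toRingHom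
      (MvPolynomial.uniqueAlgEquiv R (Fin 1)).symm.surjective
  exact prime_eq_of_etale (A := MvPolynomial (Fin 1) R) P P' hP hle

theorem isField_sections (U : (Spec (.of ℂ)).Opens) (hU : Nonempty U) :
    IsField Γ(Spec (.of ℂ), U) := by
  have hs : Subsingleton (Spec (.of ℂ)) := inferInstanceAs (Subsingleton (PrimeSpectrum ℂ))
  have : U = ⊤ := by
    ext y
    obtain ⟨x⟩ := hU
    simp only [TopologicalSpace.Opens.coe_top, Set.mem_univ, iff_true]
    rw [Subsingleton.elim y x.1]
    exact x.2
  subst this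
  exact ((Scheme.ΓSpecIso (.of ℂ)).commRingCatIsoToRingEquiv.toMulEquiv).isField
    (Field.toIsField ℂ)

theorem isClosed_of_ne_genericPoint (x : C.X) (hx : x ≠ genericPoint C.X) :
    IsClosed ({x} : Set C.X) := by
  refine closure_subset_iff_isClosed.mp fun y hy ↦ ?_
  have hy : x ⤳ y := specializes_iff_mem_closure.mpr hy
  obtain ⟨U, -, V, hV, hyV, e, h⟩ :=
    SmoothOfRelativeDimension.exists_isStandardSmoothOfRelativeDimension (n := 1) (f := C.str) y
  have hxV : x ∈ V := hy.mem_open V.isOpen hyV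
  have : Nonempty V := ⟨⟨y, hyV⟩⟩
  have hsp := hV.fromSpec.isOpenEmbedding.isInducing
  let px := hV.primeIdealOf ⟨x, hxV⟩
  let py := hV.primeIdealOf ⟨y, hyV⟩
  have hpx : hV.fromSpec px = x := hV.fromSpec_primeIdealOf ⟨x, hxV⟩
  have hpy : hV.fromSpec py = y := hV.fromSpec_primeIdealOf ⟨y, hyV⟩
  have hle : px ≤ py := by
    rw [PrimeSpectrum.le_iff_specializes]
    exact hsp.specializes_iff.mp (by rwa [hpx, hpy])
  have hne : px.asIdeal ≠ ⊥ := by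
    intro h0
    apply hx
    rw [← hpx, ← genericPoint_eq_of_isOpenImmersion hV.fromSpec, genericPoint_eq_bot_of_affine]
    congr 1
    exact PrimeSpectrum.ext h0
  have heq : px = py := PrimeSpectrum.ext (prime_eq_of_standardSmooth
    (isField_sections U ⟨⟨C.str y, e hyV⟩⟩) h px.asIdeal py.asIdeal hne hle)
  rw [Set.mem_singleton_iff, ← hpx, ← hpy, heq]

theorem finite_of_isClosed (Z : Set C.X) (hZ : IsClosed Z) (hg : genericPoint C.X ∉ Z) :
    Z.Finite := by
  have : IsLocallyNoetherian C.X := LocallyOfFiniteType.isLocallyNoetherian C.str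
  have : CompactSpace C.X := QuasiCompact.compactSpace_of_compactSpace C.str
  have : IsNoetherian C.X := { }
  obtain ⟨S, hS, hSc, hSi, rfl⟩ :=
    TopologicalSpace.NoetherianSpace.exists_finite_set_isClosed_irreducible hZ
  refine hS.sUnion fun T hT ↦ ?_
  have hx := (hSi T hT).isGenericPoint_genericPoint_closure
  rw [(hSc T hT).closure_eq] at hx
  have hcl := C.isClosed_of_ne_genericPoint _ fun h ↦ hg ⟨T, hT, h ▸ hx.mem⟩
  rw [← hx.def, hcl.closure_eq]
  exact Set.finite_singleton _

/-! ### Functions and differential forms -/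

instance algebraStalk (x : C.X) : Algebra ℂ (C.X.presheaf.stalk x) :=
  ((Scheme.ΓSpecIso (.of ℂ)).inv ≫ C.str.appTop ≫ 
    C.X.presheaf.germ ⊤ x (TopologicalSpace.Opens.mem_top x)).hom.toAlgebra

instance isScalarTowerStalk (x : C.X) :
    IsScalarTower ℂ (C.X.presheaf.stalk x) C.X.functionField := by
  apply IsScalarTower.of_algebraMap_eq'
  simp_rw [RingHom.algebraMap_toAlgebra]
  rw [← CommRingCat.hom_comp, Category.assoc, Category.assoc,
    TopCat.Presheaf.germ_stalkSpecializes]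

/-- The function field `ℂ(C)`. -/
abbrev K : Type := C.X.functionField

/-- The rational differential forms on `C`. -/
abbrev RatForm : Type := KaehlerDifferential ℂ C.K

/-- The rational functions that are regular at `x`: the local ring at `x`. -/
def regularFunctions (x : C.X) : Submodule ℂ C.K :=
  LinearMap.range (IsScalarTower.toAlgHom ℂ (C.X.presheaf.stalk x) C.K).toLinearMap

/-- The rational differential forms that are regular at `x`: the stalk at `x` of the sheaf of
differentials, which is a submodule over the local ring at `x`. -/
def regularForms (x : C.X) : Submodule (C.X.presheaf.stalk x) C.RatForm :=
  LinearMap.range (KaehlerDifferential.map ℂ ℂ (C.X.presheaf.stalk x) C.K)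

/-- The regular differential forms on `C`: the space `Γ(Ω_C)`. -/
def globalForms : Submodule ℂ C.RatForm :=
  ⨅ x : C.X, (C.regularForms x).restrictScalars ℂ

/-- The regular form `η` vanishes at `x`: it lies in the maximal ideal times the stalk of `Ω_C`. -/
def VanishesAt (η : C.RatForm) (x : C.X) : Prop :=
  η ∈ IsLocalRing.maximalIdeal (C.X.presheaf.stalk x) • C.regularForms x

/-! ### First cohomology, through the adelic complex -/

section H1

variable {M : Type} [AddCommGroup M] [Module ℂ M] (L : C.Point → Submodule ℂ M)

/-- The adeles (répartitions) of a sheaf with generic stalk `M` and stalks `L p ⊆ M`: families of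
elements of `M`, almost all of which lie in `L p`. -/
def adeles : Submodule ℂ (C.Point → M) where
  carrier := {a | {p | a p ∉ L p}.Finite}
  zero_mem' := by simp
  add_mem' {a b} ha hb := (ha.union hb).subset fun p hp ↦ by
    by_contra h
    simp only [Set.mem_union, Set.mem_ofPred_eq, not_or, not_not] at h
    exact hp ((L p).add_mem h.1 h.2)
  smul_mem' c a ha := ha.subset fun p hp h ↦ hp ((L p).smul_mem c h)

/-- The adeles that are sums of an everywhere regular adele and of a constant one. -/
def adelicCoboundaries : Submodule ℂ (C.adeles L) :=
  (Submodule.pi Set.univ L ⊔ LinearMap.range (LinearMap.pi fun _ : C.Point ↦ LinearMap.id)).comap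
    (C.adeles L).subtype

/-- The first cohomology of the locally free sheaf with generic stalk `M` and stalks `L p ⊆ M`,
as the cokernel of the adelic complex `M ⊕ ∏ p, L p → adeles`. -/
abbrev H1 : Type := C.adeles L ⧸ C.adelicCoboundaries L

end H1

/-- `H¹(C, 𝒪_C)`. -/
abbrev H1O : Type := C.H1 fun p ↦ C.regularFunctions p.1

/-- `H¹(C, Ω_C)`. -/
abbrev H1Ω : Type := C.H1 fun p ↦ (C.regularForms p.1).restrictScalars ℂ

/-- The genus `h¹(C, 𝒪_C)`. -/
def genus : ℕ := Module.finrank ℂ C.H1O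

variable {C}

theorem smul_mem_regularForms {x : C.X} {g : C.K} (hg : g ∈ C.regularFunctions x)
    {ω : C.RatForm} (hω : ω ∈ C.regularForms x) : g • ω ∈ C.regularForms x := by
  obtain ⟨s, rfl⟩ := hg
  have := (C.regularForms x).smul_mem s hω
  rwa [← algebraMap_smul C.K s ω] at this

/-- Multiplication of adeles of functions by a regular form. -/
def mulAdele (η : C.globalForms) :
    C.adeles (fun p ↦ C.regularFunctions p.1) →ₗ[ℂ]
      C.adeles (fun p ↦ (C.regularForms p.1).restrictScalars ℂ) where
  toFun a := ⟨fun p ↦ a.1 p • η.1, a.2.subset fun p hp h ↦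
    hp (smul_mem_regularForms h ((Submodule.mem_iInf _).mp η.2 p.1))⟩
  map_add' a b := by ext p; exact add_smul _ _ _
  map_smul' c a := by ext p; exact smul_assoc c (a.1 p) η.1

/-- The cup product `H¹(C, 𝒪_C) → H¹(C, Ω_C)` with a regular form. -/
def cup (η : C.globalForms) : C.H1O →ₗ[ℂ] C.H1Ω :=
  Submodule.mapQ _ _ (mulAdele η) <| by
    rintro a ha
    obtain ⟨b, hb, c, ⟨g, rfl⟩, h⟩ := Submodule.mem_sup.mp ha
    refine Submodule.mem_sup.mpr ⟨fun p ↦ b p • η.1, fun p _ ↦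
      smul_mem_regularForms (hb p trivial) ((Submodule.mem_iInf _).mp η.2 p.1), _,
      ⟨g • η.1, rfl⟩, ?_⟩
    funext p
    have := congr_fun h p
    change b p • η.1 + g • η.1 = a.1 p • η.1
    rw [← add_smul]
    exact congrArg (· • η.1) this

/-- The map `Γ(Ω_C) → H¹(C, 𝒪_C)^∨` of Serre duality that corresponds to a trace functional
`t : H¹(C, Ω_C) → ℂ`. -/
def serreMap (t : C.H1Ω →ₗ[ℂ] ℂ) (η : C.globalForms) : C.H1O →ₗ[ℂ] ℂ := t ∘ₗ cup η

end SmoothProjectiveCurve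

/-! ### Nonconstant maps and the trace -/

/-- A nonconstant morphism of curves over `ℂ`. -/
structure NonconstantMap (C E : SmoothProjectiveCurve) where
  /-- the morphism of schemes -/
  hom : C.X ⟶ E.X
  w : hom ≫ E.str = C.str
  nonconstant : ¬ ∃ y, ∀ x, hom x = y

namespace NonconstantMap

variable {C E : SmoothProjectiveCurve} (f : NonconstantMap C E)

theorem map_genericPoint : f.hom (genericPoint C.X) = genericPoint E.X := by
  by_contra h
  refine f.nonconstant ⟨f.hom (genericPoint C.X), fun x ↦ ?_⟩
  have h1 := E.isClosed_of_ne_genericPoint _ h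
  have h2 : f.hom (genericPoint C.X) ⤳ f.hom x :=
    ((genericPoint_spec C.X).specializes trivial).map f.hom.continuous
  exact h2.mem_closed h1 rfl

theorem genericPoint_specializes : f.hom (genericPoint C.X) ⤳ genericPoint E.X :=
  specializes_of_eq f.map_genericPoint

/-- Pullback of rational functions. -/
def pullbackK : E.K →ₐ[ℂ] C.K where
  toRingHom := (E.X.presheaf.stalkSpecializes f.genericPoint_specializes ≫
    f.hom.stalkMap (genericPoint C.X)).hom
  commutes' c := by
    have h : (Scheme.ΓSpecIso (.of ℂ)).inv ≫ E.str.appTop ≫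
        E.X.presheaf.germ ⊤ (genericPoint E.X) (TopologicalSpace.Opens.mem_top _) ≫
        E.X.presheaf.stalkSpecializes f.genericPoint_specializes ≫
        f.hom.stalkMap (genericPoint C.X) = (Scheme.ΓSpecIso (.of ℂ)).inv ≫ C.str.appTop ≫
        C.X.presheaf.germ ⊤ (genericPoint C.X) (TopologicalSpace.Opens.mem_top _) := by
      rw [TopCat.Presheaf.germ_stalkSpecializes_assoc, Scheme.Hom.germ_stalkMap, ← f.w,
        Scheme.Hom.comp_appTop, Category.assoc]
      rfl
    exact congr($h c)

theorem pullbackK_mem {x : C.X} {g : E.K} (hg : g ∈ E.regularFunctions (f.hom x)) :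
    f.pullbackK g ∈ C.regularFunctions x := by
  obtain ⟨s, rfl⟩ := hg
  refine ⟨f.hom.stalkMap x s, ?_⟩
  have hx : genericPoint C.X ⤳ x := (genericPoint_spec C.X).specializes trivial
  have h : E.X.presheaf.stalkSpecializes ((genericPoint_spec E.X).specializes trivial) ≫
      E.X.presheaf.stalkSpecializes f.genericPoint_specializes ≫
      f.hom.stalkMap (genericPoint C.X) =
      f.hom.stalkMap x ≫ C.X.presheaf.stalkSpecializes hx := by
    rw [TopCat.Presheaf.stalkSpecializes_comp_assoc, ← Scheme.Hom.stalkSpecializes_stalkMap]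
  exact congr($h s).symm

/-- The image of a closed point. -/
def mapPoint (p : C.Point) : E.Point :=
  ⟨f.hom p.1, by
    have : IsProper (f.hom ≫ E.str) := f.w ▸ C.proper
    have : IsProper f.hom := IsProper.of_comp f.hom E.str
    simpa using f.hom.isClosedMap _ p.2⟩

theorem finite_preimage (S : Set E.Point) (hS : S.Finite) : (f.mapPoint ⁻¹' S).Finite := by
  have hcl : IsClosed (Subtype.val '' S : Set E.X) := by
    rw [← Set.biUnion_of_singleton (Subtype.val '' S)]
    refine (hS.image _).isClosed_biUnion ?_
    rintro _ ⟨p, -, rfl⟩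
    exact p.2
  refine Set.Finite.of_finite_image (f := Subtype.val)
    ((C.finite_of_isClosed _ (hcl.preimage f.hom.continuous) ?_).subset ?_)
    Subtype.val_injective.injOn
  · rintro ⟨p, -, hp⟩
    rw [f.map_genericPoint] at hp
    refine f.nonconstant ⟨p.1, fun x ↦ ?_⟩
    have h : genericPoint E.X ⤳ f.hom x := (genericPoint_spec E.X).specializes trivial
    exact (hp ▸ h).mem_closed p.2 rfl
  · rintro _ ⟨p, hp, rfl⟩
    exact ⟨f.mapPoint p, hp, rfl⟩

/-- Pullback of adeles of functions. -/
def pullbackAdele : E.adeles (fun p ↦ E.regularFunctions p.1) →ₗ[ℂ]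
    C.adeles (fun p ↦ C.regularFunctions p.1) where
  toFun a := ⟨fun p ↦ f.pullbackK (a.1 (f.mapPoint p)),
    (f.finite_preimage _ a.2).subset fun _ hp h ↦ hp (f.pullbackK_mem h)⟩
  map_add' a b := by ext p; exact map_add f.pullbackK _ _
  map_smul' c a := by ext p; exact map_smul f.pullbackK _ _

/-- The pullback map `f^* : H¹(E, 𝒪_E) → H¹(C, 𝒪_C)`. -/
def pullbackH1 : E.H1O →ₗ[ℂ] C.H1O :=
  Submodule.mapQ _ _ f.pullbackAdele <| by
    rintro a ha
    obtain ⟨b, hb, c, ⟨g, rfl⟩, h⟩ := Submodule.mem_sup.mp ha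
    refine Submodule.mem_sup.mpr ⟨fun p ↦ f.pullbackK (b (f.mapPoint p)), fun p _ ↦
      f.pullbackK_mem (hb (f.mapPoint p) trivial), _, ⟨f.pullbackK g, rfl⟩, ?_⟩
    funext p
    exact (map_add f.pullbackK _ _).symm.trans
      (congrArg f.pullbackK (congr_fun h (f.mapPoint p)))

/-- `θ = Tr(η)`: the regular form `θ` on `E` is the image of the regular form `η` on `C` under the
Serre dual of `f^* : H¹(E, 𝒪_E) → H¹(C, 𝒪_C)`, where Serre duality is taken with respect to
the trace functionals `tC` and `tE`. -/
def IsTrace (tC : C.H1Ω →ₗ[ℂ] ℂ) (tE : E.H1Ω →ₗ[ℂ] ℂ) (η : C.globalForms) (θ : E.globalForms) :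
    Prop :=
  E.serreMap tE θ = C.serreMap tC η ∘ₗ f.pullbackH1

/-- `f` is quasi-traceless relative to `r`: the trace of a regular form `η` on `C` that vanishes at
`r` exists, is unique and is zero, whatever trace functionals are used for Serre duality.  (The
spaces `H¹(C, Ω_C)` and `H¹(E, Ω_E)` are lines, so these functionals are unique up to scaling.) -/
def IsQuasiTraceless (r : C.Point) : Prop :=
  ∀ (tC : C.H1Ω →ₗ[ℂ] ℂ) (tE : E.H1Ω →ₗ[ℂ] ℂ), tC ≠ 0 → tE ≠ 0 →
    ∀ η : C.globalForms, C.VanishesAt η r.1 →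
      ∀ θ : E.globalForms, f.IsTrace tC tE η θ ↔ θ = 0

end NonconstantMap

/-! ## Graded symmetric algebras and relative `Proj` -/

namespace SymmetricAlgebra

section Grading

variable (R M : Type) [CommRing R] [AddCommGroup M] [Module R M]

/-- The grading of the symmetric algebra: `Sym^n M` is spanned by the products of `n` elements
of `M`. -/
def grading (n : ℕ) : Submodule R (SymmetricAlgebra R M) := LinearMap.range (ι R M) ^ n

instance grading_gradedMonoid : SetLike.GradedMonoid (grading R M) :=
  inferInstanceAs (SetLike.GradedMonoid (LinearMap.range (ι R M) ^ ·))

variable {R M} in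
theorem ι_mem_grading (v : M) : ι R M v ∈ grading R M 1 := by
  rw [grading, pow_one]
  exact LinearMap.mem_range_self _ v

open scoped DirectSum in
/-- The map from `M` to the direct sum of the graded pieces. -/
def gradedι : M →ₗ[R] ⨁ i : ℕ, grading R M i :=
  DirectSum.lof R ℕ (fun i => grading R M i) 1 ∘ₗ (ι R M).codRestrict _ ι_mem_grading

instance gradedAlgebra : GradedAlgebra (grading R M) :=
  GradedAlgebra.ofAlgHom _ (lift (gradedι R M))
    (by
      ext m
      simp [gradedι, DirectSum.lof_eq_of, DirectSum.coeAlgHom_of])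
    fun i x => by
    obtain ⟨x, hx⟩ := x
    dsimp only [Subtype.coe_mk, DirectSum.lof_eq_of]
    unfold grading at hx
    induction hx using Submodule.pow_induction_on_left' with
    | algebraMap r =>
      rw [AlgHom.commutes, DirectSum.algebraMap_apply]; rfl
    | add x y i hx hy ihx ihy =>
      rw [map_add, ihx, ihy, ← map_add]
      rfl
    | mem_mul m hm i x hx ih =>
      obtain ⟨_, rfl⟩ := hm
      rw [map_mul, ih, lift_ι_apply]
      change DirectSum.of _ _ _ * _ = _
      rw [DirectSum.of_mul_of]
      exact DirectSum.of_eq_of_gradedMonoid_eq (Sigma.subtype_ext (add_comm _ _) rfl)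

end Grading

section Map

variable {R R' M M' : Type} [CommRing R] [CommRing R'] [AddCommGroup M] [Module R M]
  [AddCommGroup M'] [Module R' M'] {ρ : R →+* R'}

/-- The ring homomorphism `Sym_R M → Sym_{R'} M'` induced by a semilinear map `M → M'`. -/
def mapSemilinear (φ : M →ₛₗ[ρ] M') : SymmetricAlgebra R M →+* SymmetricAlgebra R' M' :=
  letI := ((algebraMap R' (SymmetricAlgebra R' M')).comp ρ).toAlgebra
  (lift (R := R) (A := SymmetricAlgebra R' M')
    { toFun := fun v ↦ ι R' M' (φ v)
      map_add' := fun v w ↦ by simp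
      map_smul' := fun r v ↦ by
        rw [φ.map_smulₛₗ, map_smul, Algebra.smul_def, RingHom.id_apply, Algebra.smul_def]
        rfl } : SymmetricAlgebra R M →ₐ[R] SymmetricAlgebra R' M').toRingHom

theorem mapSemilinear_ι (φ : M →ₛₗ[ρ] M') (v : M) :
    mapSemilinear φ (ι R M v) = ι R' M' (φ v) := by
  let := ((algebraMap R' (SymmetricAlgebra R' M')).comp ρ).toAlgebra
  exact lift_ι_apply ..

theorem mapSemilinear_algebraMap (φ : M →ₛₗ[ρ] M') (r : R) :
    mapSemilinear φ (algebraMap R _ r) = algebraMap R' _ (ρ r) := by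
  let := ((algebraMap R' (SymmetricAlgebra R' M')).comp ρ).toAlgebra
  exact AlgHom.commutes _ r

/-- `SymmetricAlgebra.mapSemilinear` as a homomorphism of graded rings. -/
def gradedMap (φ : M →ₛₗ[ρ] M') : grading R M →+*ᵍ grading R' M' where
  __ := mapSemilinear φ
  map_mem := by
    intro n x hx
    unfold grading at hx
    change mapSemilinear φ x ∈ _
    induction hx using Submodule.pow_induction_on_left' with
    | algebraMap r =>
      rw [mapSemilinear_algebraMap, grading, pow_zero]
      exact Submodule.algebraMap_mem _
    | add x y i hx hy ihx ihy =>
      rw [map_add]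
      exact add_mem ihx ihy
    | mem_mul m hm i x hx ih =>
      obtain ⟨v, rfl⟩ := hm
      rw [map_mul, mapSemilinear_ι, Nat.succ_eq_one_add]
      exact SetLike.mul_mem_graded (ι_mem_grading _) ih

/-- For a linear form `ℓ` on `M` with `ℓ v = 1`, the evaluation `w / v ↦ ℓ w` on the ring of
functions on the open subset `D₊(v)` of `Proj (Sym M)`. -/
def awayEval (ℓ : M →ₗ[R] R) (v : M) (h : ℓ v = 1) :
    HomogeneousLocalization.Away (grading R M) (ι R M v) →+* R :=
  (IsLocalization.Away.lift (S := Localization.Away (ι R M v)) (ι R M v)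
    (g := (lift ℓ : SymmetricAlgebra R M →ₐ[R] R).toRingHom) (by simp [h])).comp
    (algebraMap _ (Localization.Away (ι R M v)))

end Map

end SymmetricAlgebra

open SymmetricAlgebra in
/-- The structure morphism `Proj (Sym_R M) → Spec R`. -/
def projSymToSpec (R : CommRingCat.{0}) (M : Type) [AddCommGroup M] [Module R M] :
    Proj (grading R M) ⟶ Spec R :=
  Proj.toSpecZero (grading R M) ≫ Spec.map (CommRingCat.ofHom (algebraMap R (grading R M 0)))

namespace AlgebraicGeometry.Scheme.Modules

variable {X : Scheme.{0}} (V : X.Modules)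

/-- Restriction of sections of a sheaf of modules, as a semilinear map. -/
def restriction {U W : X.Opens} (h : U ≤ W) :
    Γ(V, W) →ₛₗ[(X.presheaf.map (homOfLE h).op).hom] Γ(V, U) where
  toFun := V.presheaf.map (homOfLE h).op
  map_add' := map_add _
  map_smul' := V.map_smul (homOfLE h)

variable (X) in
/-- The structure sheaf as a sheaf of modules over itself. -/
abbrev structureSheaf : X.Modules := SheafOfModules.unit X.ringCatSheaf

/-- The linear form on `Γ(V, U)` given by a morphism `V ⟶ 𝒪_X`. -/
def linearForm {V : X.Modules} (π : V ⟶ structureSheaf X) (U : X.Opens) :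
    Γ(V, U) →ₗ[Γ(X, U)] Γ(X, U) where
  toFun v := show Γ(structureSheaf X, U) from π.app U v
  map_add' := map_add (π.app U).hom
  map_smul' := π.app_smul

end AlgebraicGeometry.Scheme.Modules

open SymmetricAlgebra Scheme.Modules

/-- The data identifying `ς : S ⟶ X` with the relative `Proj` of the symmetric algebra of a
quasi-coherent sheaf `V` on `X`: over every affine open `U` of `X`, an isomorphism of `ς⁻¹ U` with
`Proj (Sym Γ(V, U))`, compatibly with restriction to smaller affine opens. -/
structure RelativeProjSym {X S : Scheme.{0}} (V : X.Modules) (ς : S ⟶ X) where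
  /-- the open immersion `Proj (Sym Γ(V, U)) ⟶ S` onto `ς⁻¹ U` -/
  chart (U : X.affineOpens) : Proj (grading Γ(X, U) Γ(V, U)) ⟶ S
  isPullback (U : X.affineOpens) :
    IsPullback (chart U) (projSymToSpec Γ(X, U) Γ(V, U)) ς U.2.fromSpec
  /-- for `v ∈ Γ(V, W)` and `U ≤ W`, the inclusions of `D₊(v|_U)` into `S` through the charts
  of `U` and of `W` agree -/
  compatible (U W : X.affineOpens) (h : U ≤ W) (v : Γ(V, W)) :
    Proj.awayι (grading Γ(X, U) Γ(V, U)) (gradedMap (V.restriction h) (ι _ _ v))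
        ((gradedMap (V.restriction h)).map_mem (ι_mem_grading v)) one_pos ≫ chart U =
      Spec.map (CommRingCat.ofHom
        (HomogeneousLocalization.Away.map (gradedMap (V.restriction h)) (ι _ _ v))) ≫
      Proj.awayι (grading Γ(X, W) Γ(V, W)) (ι _ _ v) (ι_mem_grading v) one_pos ≫ chart W

/-- `σ` is the section of `Proj (Sym V) ⟶ X` that corresponds to the quotient `π : V ⟶ 𝒪_X`: on an
affine open `U` on which `v ∈ Γ(V, U)` maps to `1`, it is the section of `D₊(v)` with
`w / v ↦ π w`. -/
structure RelativeProjSym.IsSectionOf {X S : Scheme.{0}} {V : X.Modules} {ς : S ⟶ X}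
    (P : RelativeProjSym V ς) (π : V ⟶ structureSheaf X) (σ : X ⟶ S) : Prop where
  isSection : σ ≫ ς = 𝟙 X
  eq_on_chart (U : X.affineOpens) (v : Γ(V, U)) (hv : linearForm π U v = 1) :
    U.2.fromSpec ≫ σ = Spec.map (CommRingCat.ofHom (awayEval (linearForm π U) v hv)) ≫
      Proj.awayι (grading Γ(X, U) Γ(V, U)) (ι _ _ v) (ι_mem_grading v) one_pos ≫ P.chart U

end

/-!
Write `e` for the section `i 1` of `V`. Over an affine open `U ⊆ E` on which `π` has a section
`v`, the module `Γ(V, U)` is spanned by `e` and `v`, so `S` is covered there by `D₊(e)` and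
`D₊(v)`, and the distinguished section lies in `D₊(v)` and is cut out by the function `e / v`.
Since the lift `f'` meets it exactly in the reduced point `r`, the rational function `g_v` on `C`
obtained by pulling back `v / e` is regular over `U` away from `r`, and at `r` it is the inverse of
a generator of the maximal ideal (`NonconstantMap.exists_hasRatio`). If two local sections of `π` differ by
`i k`, the corresponding functions differ by `f^* k` (`NonconstantMap.HasRatio.sub_eq`).

Now choose local sections `v_p` near all points `p` of `E` and let `v_0` be one of them. The adele
`a_p = v_p - v_0` represents the extension class in `H¹(E, 𝒪_E)`. This class is nonzero, because a
trivialization of it would allow one to correct the `v_p` so that they glue to a splitting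
(`extensionClass_ne_zero`). As `E` has genus one, it spans `H¹(E, 𝒪_E)`. By the above, `f^* a` is
the difference of the adele `p ↦ g_{v_{f p}}` and the constant `g_{v_0}`. If `η` is a regular form
which vanishes at `r`, then `g_{v_{f p}} η` is regular everywhere, so that the cup product of `η`
with `f^* a` is zero. Hence the functional on `H¹(E, 𝒪_E)` which `η` induces is zero.

That the trace is then zero, and nothing else, is the injectivity of the Serre duality map of `E`.
It holds because cup product with a nonzero form `θ` is surjective
(`SmoothProjectiveCurve.cup_surjective`): the rational forms are a line over the function field,
so an adele of forms can be divided by `θ`.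
-/

noncomputable section

/-! ### Points of `Proj (Sym M)` with values in local rings -/

namespace SymmetricAlgebra

open HomogeneousLocalization

section Chart

variable {R M : Type} [CommRing R] [AddCommGroup M] [Module R M]

/-- The structure map `R → Away x` of the ring of functions on `D₊(x) ⊆ Proj (Sym M)`. -/
def constHom (x : SymmetricAlgebra R M) : R →+* Away (grading R M) x :=
  (fromZeroRingHom (grading R M) _).comp (algebraMap R (grading R M 0))

/-- The function `m / x` on `D₊(x) ⊆ Proj (Sym M)`, for `m ∈ M` and `x` of degree one. -/
def fraction {x : SymmetricAlgebra R M} (hx : x ∈ grading R M 1) (m : M) :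
    Away (grading R M) x :=
  Away.mk (grading R M) hx 1 (ι R M m) (by simpa using ι_mem_grading m)

theorem val_constHom (x : SymmetricAlgebra R M) (r : R) :
    (constHom x r).val = Localization.mk (algebraMap R _ r) 1 := rfl

theorem fraction_add {x : SymmetricAlgebra R M} (hx : x ∈ grading R M 1) (m n : M) :
    fraction hx (m + n) = fraction hx m + fraction hx n := by
  apply val_injective
  simp [fraction, Localization.add_mk_self]

theorem fraction_smul {x : SymmetricAlgebra R M} (hx : x ∈ grading R M 1) (r : R) (m : M) :
    fraction hx (r • m) = constHom x r * fraction hx m := by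
  apply val_injective
  simp [fraction, val_constHom, Algebra.smul_def, Localization.mk_mul]

theorem fraction_self (w : M) : fraction (ι_mem_grading (R := R) w) w = 1 := by
  apply val_injective
  simp [fraction]

/-- For `x` of degree one, the ring `Away x` is generated over `R` by the fractions `m / x`. -/
theorem away_ringHom_ext {A : Type*} [CommRing A] {x : SymmetricAlgebra R M}
    (hx : x ∈ grading R M 1) {φ ψ : Away (grading R M) x →+* A}
    (hconst : φ.comp (constHom x) = ψ.comp (constHom x))
    (hfrac : ∀ m, φ (fraction hx m) = ψ (fraction hx m)) : φ = ψ := by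
  have key (n : ℕ) (a : SymmetricAlgebra R M) (ha : a ∈ LinearMap.range (ι R M) ^ n)
      (ha' : a ∈ grading R M (n • 1)) :
      φ (Away.mk _ hx n a ha') = ψ (Away.mk _ hx n a ha') := by
    induction ha using Submodule.pow_induction_on_left' with
    | algebraMap r =>
      have : Away.mk _ hx 0 (algebraMap R _ r) ha' = constHom x r := by
        apply val_injective
        rw [val_constHom, Away.val_mk]
        congr 1
        exact Subtype.ext (pow_zero x)
      rw [this]
      exact congr($hconst r)
    | add a b n ha hb iha ihb =>
      have ha'' : a ∈ grading R M (n • 1) := by simpa [grading] using ha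
      have hb'' : b ∈ grading R M (n • 1) := by simpa [grading] using hb
      have : Away.mk _ hx n (a + b) ha' = Away.mk _ hx n a ha'' + Away.mk _ hx n b hb'' := by
        apply val_injective
        simp [Localization.add_mk_self]
      rw [this, map_add, map_add, iha, ihb]
    | mem_mul m hm n a ha ih =>
      obtain ⟨m, rfl⟩ := hm
      have ha'' : a ∈ grading R M (n • 1) := by simpa [grading] using ha
      have : Away.mk _ hx n.succ (ι R M m * a) ha' = fraction hx m * Away.mk _ hx n a ha'' := by
        apply val_injective
        simp [fraction, Localization.mk_mul, pow_succ, mul_comm]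
      rw [this, map_mul, map_mul, hfrac, ih]
  ext y
  obtain ⟨n, a, ha, rfl⟩ := Away.mk_surjective _ hx y
  exact key n a (by simpa [grading] using ha) ha

theorem awayι_projSymToSpec {R : CommRingCat.{0}} {M : Type} [AddCommGroup M] [Module R M]
    {x : SymmetricAlgebra R M} (hx : x ∈ grading R M 1) :
    Proj.awayι (grading R M) x hx one_pos ≫ projSymToSpec R M =
      Spec.map (CommRingCat.ofHom (constHom x)) := by
  rw [projSymToSpec, Proj.awayι_toSpecZero_assoc, ← Spec.map_comp]
  rfl

/-- Change of chart: for a point of `D₊(w) ∩ D₊(w')` with values in `A`, one has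
`(w' / w) * (m / w') = m / w` in `A`. -/
theorem fraction_mul_fraction_of_eq {A : CommRingCat.{0}} (w w' : M)
    {φ : Away (grading R M) (ι R M w) →+* A} {ψ : Away (grading R M) (ι R M w') →+* A}
    (h : Spec.map (CommRingCat.ofHom φ) ≫ Proj.awayι (grading R M) _ (ι_mem_grading w) one_pos =
      Spec.map (CommRingCat.ofHom ψ) ≫ Proj.awayι (grading R M) _ (ι_mem_grading w') one_pos)
    (m : M) :
    φ (fraction (ι_mem_grading w) w') * ψ (fraction (ι_mem_grading w') m) =
      φ (fraction (ι_mem_grading w) m) := by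
  let p := Proj.pullbackAwayιIso (grading R M) (ι_mem_grading w) one_pos (ι_mem_grading w') one_pos
    rfl
  let l := Limits.pullback.lift _ _ h ≫ p.hom
  obtain ⟨χ, hχ⟩ := Spec.map_surjective l
  have h1 : CommRingCat.ofHom φ = CommRingCat.ofHom (awayMap (grading R M) (ι_mem_grading w') rfl)
      ≫ χ := by
    apply Spec.map_injective
    rw [Spec.map_comp, hχ, Category.assoc, Proj.pullbackAwayιIso_hom_SpecMap_awayMap_left,
      Limits.pullback.lift_fst]
  have h2 : CommRingCat.ofHom ψ =
      CommRingCat.ofHom (awayMap (grading R M) (ι_mem_grading w) (mul_comm _ _)) ≫ χ := by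
    apply Spec.map_injective
    rw [Spec.map_comp, hχ, Category.assoc, Proj.pullbackAwayιIso_hom_SpecMap_awayMap_right,
      Limits.pullback.lift_snd]
  have h1 : φ = χ.hom.comp (awayMap (grading R M) (ι_mem_grading w') rfl) := congr($(h1).hom)
  have h2 : ψ = χ.hom.comp (awayMap (grading R M) (ι_mem_grading w) (mul_comm _ _)) :=
    congr($(h2).hom)
  subst h1 h2
  simp only [RingHom.comp_apply]
  rw [← map_mul]
  congr 1
  apply val_injective
  rw [val_mul]
  simp only [fraction, awayMap_mk, Away.val_mk, Localization.mk_mul]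
  rw [Localization.mk_eq_mk_iff, Localization.r_iff_exists]
  refine ⟨1, ?_⟩
  simp
  ring

/-- If `v` and `w` span `M`, they generate the irrelevant ideal of `Sym M`. -/
theorem basicOpen_sup_eq_top {v w : M} (h : Submodule.span R {v, w} = ⊤) :
    Proj.basicOpen (grading R M) (ι R M v) ⊔ Proj.basicOpen (grading R M) (ι R M w) = ⊤ := by
  rw [eq_top_iff]
  rintro p -
  by_contra hp
  rw [TopologicalSpace.Opens.mem_sup, not_or, Proj.mem_basicOpen, Proj.mem_basicOpen,
    not_not, not_not] at hp
  refine p.not_irrelevant_le (HomogeneousIdeal.toIdeal_irrelevant_le _ |>.mpr fun n hn x hx ↦ ?_)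
  obtain ⟨n, rfl⟩ := Nat.exists_eq_succ_of_ne_zero hn.ne'
  change x ∈ LinearMap.range (ι R M) ^ (n + 1) at hx
  have hι (m : M) : ι R M m ∈ p.asHomogeneousIdeal.toIdeal := by
    have hm : m ∈ Submodule.span R {v, w} := h ▸ trivial
    obtain ⟨a, b, rfl⟩ := Submodule.mem_span_pair.mp hm
    rw [map_add, map_smul, map_smul, Algebra.smul_def, Algebra.smul_def]
    exact add_mem (Ideal.mul_mem_left _ _ hp.1) (Ideal.mul_mem_left _ _ hp.2)
  rw [pow_succ'] at hx
  change x ∈ p.asHomogeneousIdeal.toIdeal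
  induction hx using Submodule.mul_induction_on' with
  | mem_mul_mem a ha b hb =>
    obtain ⟨m, rfl⟩ := ha
    exact Ideal.mul_mem_right _ _ (hι m)
  | add a _ b _ ha hb => exact add_mem ha hb

theorem awayEval_constHom (ℓ : M →ₗ[R] R) (v : M) (h : ℓ v = 1) (r : R) :
    awayEval ℓ v h (constHom _ r) = r := by
  simp only [awayEval, RingHom.comp_apply, HomogeneousLocalization.algebraMap_apply, val_constHom,
    Localization.mk_one_eq_algebraMap, IsLocalization.Away.lift_eq]
  simp

theorem awayEval_fraction (ℓ : M →ₗ[R] R) (v : M) (h : ℓ v = 1) (m : M) :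
    awayEval ℓ v h (fraction (ι_mem_grading v) m) = ℓ m := by
  simp only [awayEval, RingHom.comp_apply, HomogeneousLocalization.algebraMap_apply, fraction,
    Away.val_mk, Localization.mk_eq_mk', IsLocalization.Away.lift, IsLocalization.lift_mk'_spec]
  simp [h]

theorem awayMap_fraction {R' M' : Type} [CommRing R'] [AddCommGroup M'] [Module R' M']
    {ρ : R →+* R'} (φ : M →ₛₗ[ρ] M') {x : SymmetricAlgebra R M} (hx : x ∈ grading R M 1) (m : M) :
    Away.map (gradedMap φ) x (fraction hx m) = fraction ((gradedMap φ).map_mem hx) (φ m) := by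
  apply val_injective
  rw [fraction, Away.map_mk, fraction, Away.val_mk, Away.val_mk]
  congr 1
  exact mapSemilinear_ι φ m

end Chart

end SymmetricAlgebra

/-- A morphism from the spectrum of a local ring factors through every open subset that contains
the image of the closed point. -/
theorem AlgebraicGeometry.exists_eq_specMap_comp {A B : CommRingCat.{0}} [IsLocalRing A]
    {Y : Scheme.{0}} (q : Spec A ⟶ Y) (j : Spec B ⟶ Y) [IsOpenImmersion j]
    (h : q (IsLocalRing.closedPoint A) ∈ j.opensRange) :
    ∃ φ : B ⟶ A, q = Spec.map φ ≫ j := by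
  have hle : Set.range q ⊆ Set.range j := by
    rintro _ ⟨z, rfl⟩
    exact ((IsLocalRing.specializes_closedPoint z).map q.continuous).mem_open j.opensRange.2 h
  obtain ⟨φ, hφ⟩ := Spec.map_surjective (IsOpenImmersion.lift j q hle)
  exact ⟨φ, by rw [hφ, IsOpenImmersion.lift_fac]⟩

open SymmetricAlgebra HomogeneousLocalization in
theorem SymmetricAlgebra.exists_lift_of_isLocalRing {R M : Type} [CommRing R] [AddCommGroup M]
    [Module R M] {v w : M} (h : Submodule.span R {v, w} = ⊤) {A : CommRingCat.{0}} [IsLocalRing A]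
    (q : Spec A ⟶ Proj (grading R M)) :
    (∃ φ : Away (grading R M) (ι R M v) →+* A,
      q = Spec.map (CommRingCat.ofHom φ) ≫ Proj.awayι _ _ (ι_mem_grading v) one_pos) ∨
    (∃ φ : Away (grading R M) (ι R M w) →+* A,
      q = Spec.map (CommRingCat.ofHom φ) ≫ Proj.awayι _ _ (ι_mem_grading w) one_pos) := by
  have hq : q (IsLocalRing.closedPoint A) ∈
      Proj.basicOpen (grading R M) (ι R M v) ⊔ Proj.basicOpen (grading R M) (ι R M w) := by
    rw [basicOpen_sup_eq_top h]; trivial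
  rw [TopologicalSpace.Opens.mem_sup, ← Proj.opensRange_awayι _ _ (ι_mem_grading v) one_pos,
    ← Proj.opensRange_awayι _ _ (ι_mem_grading w) one_pos] at hq
  refine hq.imp (fun h ↦ ?_) fun h ↦ ?_ <;>
  · obtain ⟨φ, hφ⟩ := exists_eq_specMap_comp q _ h
    exact ⟨φ.hom, hφ⟩

open SymmetricAlgebra HomogeneousLocalization Scheme.Modules

/-- A point of `D₊(v)` at which the function `w / v` is a unit is a point of `D₊(w)`. -/
theorem SymmetricAlgebra.exists_lift_of_isUnit {R M : Type} [CommRing R] [AddCommGroup M]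
    [Module R M] (v w : M) {A : CommRingCat.{0}} [IsLocalRing A]
    (φ : Away (grading R M) (ι R M v) →+* A) (h : IsUnit (φ (fraction (ι_mem_grading v) w))) :
    ∃ ψ : Away (grading R M) (ι R M w) →+* A,
      Spec.map (CommRingCat.ofHom φ) ≫ Proj.awayι _ _ (ι_mem_grading v) one_pos =
        Spec.map (CommRingCat.ofHom ψ) ≫ Proj.awayι _ _ (ι_mem_grading w) one_pos := by
  have hmem : Spec.map (CommRingCat.ofHom φ) (IsLocalRing.closedPoint A) ∈
      Proj.awayι _ _ (ι_mem_grading v) one_pos ⁻¹ᵁ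
        (Proj.awayι (grading R M) _ (ι_mem_grading w) one_pos).opensRange := by
    rw [Proj.opensRange_awayι, Proj.awayι_preimage_basicOpen _ (ι_mem_grading v) one_pos
      (ι_mem_grading w) one_pos]
    have hf : Away.isLocalizationElem (ι_mem_grading v) (ι_mem_grading w) =
        fraction (ι_mem_grading (R := R) v) w := by
      simp only [Away.isLocalizationElem, fraction, pow_one]
    rw [hf]
    intro hm
    exact (IsLocalRing.mem_maximalIdeal _).mp hm h
  obtain ⟨ψ, hψ⟩ := exists_eq_specMap_comp
    (Spec.map (CommRingCat.ofHom φ) ≫ Proj.awayι _ _ (ι_mem_grading v) one_pos)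
    (Proj.awayι _ _ (ι_mem_grading w) one_pos) hmem
  exact ⟨ψ.hom, hψ⟩

/-- If `M` is spanned by `e` and `v`, with `ℓ e = 0` and `ℓ v = 1`, then the section of `D₊(v)`
given by `ℓ` is the locus where the function `e / v` vanishes. -/
theorem SymmetricAlgebra.eq_comp_awayEval {R M A : Type} [CommRing R] [AddCommGroup M]
    [Module R M] [CommRing A] (ℓ : M →ₗ[R] R) {v e : M} (hv : ℓ v = 1) (he : ℓ e = 0)
    (hspan : Submodule.span R {e, v} = ⊤) {ρ : R →+* A} {φ : Away (grading R M) (ι R M v) →+* A}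
    (hc : φ.comp (constHom _) = ρ) (h0 : φ (fraction (ι_mem_grading v) e) = 0) :
    φ = ρ.comp (awayEval ℓ v hv) := by
  subst hc
  refine away_ringHom_ext (ι_mem_grading v) ?_ fun m ↦ ?_
  · ext a
    simp only [RingHom.comp_apply, awayEval_constHom]
  · have hm : m ∈ Submodule.span R {e, v} := hspan ▸ trivial
    obtain ⟨b, a, rfl⟩ := Submodule.mem_span_pair.mp hm
    simp [fraction_add, fraction_smul, h0, fraction_self, awayEval_constHom, awayEval_fraction, he]

/-! ### Exactness of sections of sheaves of modules -/

/-- If `L` is a reflection, then an epimorphism `p` of the reflective subcategory need not have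
zero cokernel in the ambient category, but this cokernel is killed by `L`. -/
theorem CategoryTheory.Adjunction.cokernel_comp_unit_eq_zero {C D : Type*} [Category* C]
    [Category* D] [Preadditive C] [Limits.HasCokernels C] [Preadditive D]
    {L : C ⥤ D} {F : D ⥤ C} (adj : L ⊣ F)
    [F.PreservesZeroMorphisms] [L.PreservesZeroMorphisms] [IsIso adj.counit]
    {M N : D} (p : M ⟶ N) [Epi p] :
    Limits.cokernel.π (F.map p) ≫ adj.unit.app _ = 0 := by
  have h : L.map (F.map p) = adj.counit.app M ≫ p ≫ inv (adj.counit.app N) := by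
    rw [← Category.assoc, IsIso.eq_comp_inv]
    exact adj.counit.naturality p
  have : Epi (L.map (F.map p)) := by
    rw [h]
    infer_instance
  have hL : L.map (Limits.cokernel.π (F.map p)) = 0 := by
    rw [← cancel_epi (L.map (F.map p)), ← L.map_comp, Limits.cokernel.condition, L.map_zero,
      Limits.comp_zero]
  erw [← adj.unit_naturality]
  rw [hL, F.map_zero, Limits.comp_zero]

namespace AlgebraicGeometry.Scheme.Modules

variable {X : Scheme.{0}}

instance (U : X.Opens) :
    (toPresheaf X ⋙ (CategoryTheory.evaluation _ _).obj (.op U)).PreservesZeroMorphisms where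
  map_zero _ _ := rfl

instance (U : X.Opens) :
    Limits.PreservesLimits (toPresheaf X ⋙ (CategoryTheory.evaluation _ _).obj (.op U)) :=
  have : Limits.PreservesLimits ((CategoryTheory.evaluation X.Opensᵒᵖ Ab.{0}).obj (.op U)) :=
    Limits.evaluationPreservesLimits _
  Limits.comp_preservesLimits _ _

theorem app_injective_of_mono {M N : X.Modules} (i : M ⟶ N) [Mono i] (U : X.Opens) :
    Function.Injective (i.app U) := by
  have : Mono ((toPresheaf X ⋙ (CategoryTheory.evaluation _ _).obj (.op U)).map i) := inferInstance
  exact (AddCommGrpCat.mono_iff_injective _).mp this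

/-- Taking sections is left exact. -/
theorem exists_app_eq_of_shortExact {S : ShortComplex X.Modules} (hS : S.ShortExact) (U : X.Opens)
    (v : Γ(S.X₂, U)) (hv : S.g.app U v = 0) : ∃ a : Γ(S.X₁, U), S.f.app U a = v := by
  have := hS.mono_f
  have := hS.exact.map_of_mono_of_preservesKernel
    (toPresheaf X ⋙ (CategoryTheory.evaluation _ _).obj (.op U)) hS.mono_f inferInstance
  rw [ShortComplex.ab_exact_iff] at this
  exact this v hv

/-- An epimorphism of sheaves of modules is locally surjective. -/
theorem exists_app_eq_of_epi {M N : X.Modules} (p : M ⟶ N) [Epi p] (U : X.Opens) (t : Γ(N, U))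
    (x : X) (hx : x ∈ U) : ∃ (W : X.Opens) (h : W ≤ U) (_ : x ∈ W) (s : Γ(M, W)),
      p.app W s = N.presheaf.map (homOfLE h).op t := by
  let adj := PresheafOfModules.sheafificationAdjunction (𝟙 X.ringCatSheaf.obj)
  let F := SheafOfModules.forget X.ringCatSheaf ⋙
    PresheafOfModules.restrictScalars (𝟙 X.ringCatSheaf.obj)
  let M' : SheafOfModules X.ringCatSheaf := M
  let N' : SheafOfModules X.ringCatSheaf := N
  let p' : M' ⟶ N' := p
  have : Epi p' := ‹Epi p›
  have : F.PreservesZeroMorphisms := { }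
  have := adj.left_adjoint_additive
  let c := Limits.cokernel.π (F.map p')
  have h0 : c ≫ adj.unit.app _ = 0 := adj.cokernel_comp_unit_eq_zero p'
  -- A section of `N` dies in the sheafification of the presheaf cokernel `c`, hence dies in the
  -- presheaf cokernel itself after restriction to a neighbourhood of `x`.
  have h1 : (CategoryTheory.toSheafify (Opens.grothendieckTopology X)
      (Limits.cokernel (F.map p')).presheaf).app (.op U)
      (((PresheafOfModules.toPresheaf _).map c).app (.op U) t) = 0 :=
    congr(((PresheafOfModules.toPresheaf _).map $h0).app (.op U) t)
  obtain ⟨W, f, hW, hxW⟩ := Presheaf.equalizerSieve_mem (Opens.grothendieckTopology X)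
    (CategoryTheory.toSheafify (Opens.grothendieckTopology X)
      (Limits.cokernel (F.map p')).presheaf)
    (((PresheafOfModules.toPresheaf _).map c).app (.op U) t) 0 (by rw [h1, map_zero]) x hx
  have h2 : ((PresheafOfModules.toPresheaf _).map c).app (.op W) (N.presheaf.map f.op t) = 0 := by
    have h3 := ConcreteCategory.congr_hom
      (((PresheafOfModules.toPresheaf _).map c).naturality f.op) t
    exact h3.trans (hW.trans (map_zero _))
  let S : ShortComplex (_root_.PresheafOfModules X.ringCatSheaf.obj) :=
    ShortComplex.mk (F.map p') c (Limits.cokernel.condition _)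
  have hS : S.Exact := ShortComplex.exact_cokernel _
  have := hS.map (PresheafOfModules.evaluation _ (.op W))
  rw [ShortComplex.moduleCat_exact_iff] at this
  obtain ⟨s, hs⟩ := this _ h2
  exact ⟨W, leOfHom f, hxW, s, hs⟩

end AlgebraicGeometry.Scheme.Modules

/-! ### Extensions of the structure sheaf by itself -/

namespace AlgebraicGeometry.Scheme.Modules

variable {X : Scheme.{0}} {V : X.Modules} (i : structureSheaf X ⟶ V) (π : V ⟶ structureSheaf X)

/-- The map `Γ(X, U) → Γ(V, U)` on sections given by a morphism `𝒪_X ⟶ V`. -/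
def ofUnit (U : X.Opens) : Γ(X, U) →ₗ[Γ(X, U)] Γ(V, U) where
  toFun a := i.app U (show Γ(structureSheaf X, U) from a)
  map_add' := map_add (i.app U).hom
  map_smul' := i.app_smul

theorem restriction_restriction {U W T : X.Opens} (h : U ≤ W) (h' : W ≤ T) (v : Γ(V, T)) :
    V.restriction h (V.restriction h' v) = V.restriction (h.trans h') v := by
  change V.presheaf.map _ (V.presheaf.map _ v) = V.presheaf.map _ v
  rw [← ConcreteCategory.comp_apply, ← V.presheaf.map_comp]
  rfl

theorem _root_.AlgebraicGeometry.Scheme.germ_map_homOfLE {U W : X.Opens} (h : U ≤ W) (x : X)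
    (hx : x ∈ U) (a : Γ(X, W)) :
    X.presheaf.germ U x hx (X.presheaf.map (homOfLE h).op a) = X.presheaf.germ W x (h hx) a :=
  X.presheaf.germ_res_apply (homOfLE h) x hx a

theorem restriction_ofUnit {U W : X.Opens} (h : U ≤ W) (a : Γ(X, W)) :
    V.restriction h (ofUnit i W a) = ofUnit i U (X.presheaf.map (homOfLE h).op a) :=
  (ConcreteCategory.congr_hom (i.mapPresheaf.naturality (homOfLE h).op)
    (show Γ(structureSheaf X, W) from a)).symm

theorem linearForm_restriction {U W : X.Opens} (h : U ≤ W) (v : Γ(V, W)) :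
    linearForm π U (V.restriction h v) = X.presheaf.map (homOfLE h).op (linearForm π W v) :=
  ConcreteCategory.congr_hom (π.mapPresheaf.naturality (homOfLE h).op) v

variable {i π}

theorem linearForm_ofUnit (w : i ≫ π = 0) (U : X.Opens) (a : Γ(X, U)) :
    linearForm π U (ofUnit i U a) = 0 :=
  congr(($w).app U (show Γ(structureSheaf X, U) from a))

theorem ofUnit_injective [Mono i] (U : X.Opens) : Function.Injective (ofUnit i U) :=
  app_injective_of_mono i U

theorem exists_ofUnit_eq {w : i ≫ π = 0} (hV : (ShortComplex.mk i π w).ShortExact) {U : X.Opens}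
    {v : Γ(V, U)} (hv : linearForm π U v = 0) : ∃ a, ofUnit i U a = v :=
  exists_app_eq_of_shortExact hV U v hv

/-- An epimorphism `V ⟶ 𝒪_X` has a section locally. -/
theorem exists_linearForm_eq_one [Epi π] (x : X) :
    ∃ (U : X.affineOpens) (_ : x ∈ U.1) (v : Γ(V, U)), linearForm π U v = 1 := by
  obtain ⟨W, hW, hxW, s, hs⟩ := exists_app_eq_of_epi π ⊤ (show Γ(X, ⊤) from 1) x trivial
  obtain ⟨_, ⟨U, hU, rfl⟩, hxU, hUW⟩ := X.isBasis_affineOpens.exists_subset_of_mem_open hxW W.2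
  replace hUW : U ≤ W := hUW
  refine ⟨⟨U, hU⟩, hxU, V.restriction hUW s, ?_⟩
  rw [linearForm_restriction]
  have : linearForm π W s = 1 := hs.trans (map_one (X.presheaf.map (homOfLE hW).op).hom)
  rw [this, map_one]

/-- A global section `s` of `V` with `π s = 1` splits the short exact sequence. -/
theorem nonempty_splitting_of_section {w : i ≫ π = 0} (hV : (ShortComplex.mk i π w).ShortExact)
    (s : Γ(V, ⊤)) (hs : linearForm π ⊤ s = 1) : Nonempty (ShortComplex.mk i π w).Splitting := by
  have := hV.mono_f
  let t : SheafOfModules.sections (show SheafOfModules X.ringCatSheaf from V) :=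
    ⟨fun U ↦ V.restriction (le_top : U.unop ≤ ⊤) s, fun {U W} f ↦
      restriction_restriction (leOfHom f.unop) le_top s⟩
  let σ : structureSheaf X ⟶ V :=
    (SheafOfModules.unitHomEquiv (show SheafOfModules X.ringCatSheaf from V)).symm t
  refine ⟨ShortComplex.Splitting.ofExactOfSection _ hV.exact σ ?_ hV.mono_f⟩
  apply (SheafOfModules.unitHomEquiv _).injective
  refine (SheafOfModules.unitHomEquiv_comp_apply _ _).trans ?_
  have hσ : SheafOfModules.unitHomEquiv (show SheafOfModules X.ringCatSheaf from V) σ = t :=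
    Equiv.apply_symm_apply _ _
  refine (congrArg _ hσ).trans ?_
  apply Subtype.ext
  funext U
  refine (linearForm_restriction π (le_top : U.unop ≤ ⊤) s).trans ?_
  rw [hs, map_one]
  rfl

variable (i) in
/-- The sections `v` and `w` of `V` differ, near the generic point, by the image under
`i : 𝒪_X ⟶ V` of the rational function `k`. -/
def GenericDiff [IrreducibleSpace X] {U W : X.Opens} (v : Γ(V, U)) (w : Γ(V, W))
    (k : X.functionField) : Prop :=
  ∃ (T : X.Opens) (hU : T ≤ U) (hW : T ≤ W) (hT : genericPoint X ∈ T) (a : Γ(X, T)),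
    ofUnit i T a = V.restriction hU v - V.restriction hW w ∧ X.presheaf.germ T _ hT a = k

/-- Two local sections of `π` differ, near any point `x` of the intersection of their domains, by
a function that is regular at `x`. -/
theorem exists_genericDiff [IrreducibleSpace X] {w : i ≫ π = 0}
    (hV : (ShortComplex.mk i π w).ShortExact) {U W : X.Opens}
    {v : Γ(V, U)} {v' : Γ(V, W)} (hv : linearForm π U v = 1) (hv' : linearForm π W v' = 1)
    (x : X) (hU : x ∈ U) (hW : x ∈ W) :
    ∃ s : X.presheaf.stalk x, GenericDiff i v v' (algebraMap _ X.functionField s) := by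
  obtain ⟨a, ha⟩ := exists_ofUnit_eq hV (v := V.restriction (inf_le_left : U ⊓ W ≤ U) v -
    V.restriction (inf_le_right : U ⊓ W ≤ W) v') (by
      rw [map_sub, linearForm_restriction, linearForm_restriction, hv, hv', map_one, map_one,
        sub_self])
  have hη : genericPoint X ∈ U ⊓ W := (genericPoint_spec X).specializes trivial |>.mem_open
    (U ⊓ W).2 ⟨hU, hW⟩
  have hx : x ∈ U ⊓ W := ⟨hU, hW⟩
  refine ⟨X.presheaf.germ _ x hx a, U ⊓ W, inf_le_left, inf_le_right, hη, a, ha, ?_⟩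
  exact (congr($(X.presheaf.germ_stalkSpecializes hx
    ((genericPoint_spec X).specializes trivial)) a)).symm

/-- On an integral scheme, two sections with the same image under `π` are equal as soon as they
agree near the generic point: their difference is a function. -/
theorem eq_of_genericDiff [IsIntegral X] [Mono i] {w : i ≫ π = 0}
    (hV : (ShortComplex.mk i π w).ShortExact) {U : X.Opens} (hU : genericPoint X ∈ U)
    {v v' : Γ(V, U)} (h : linearForm π U v = linearForm π U v') (hd : GenericDiff i v v' 0) :
    v = v' := by
  obtain ⟨a, ha⟩ := exists_ofUnit_eq hV (v := v - v') (by rw [map_sub, h, sub_self])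
  obtain ⟨T, hT, hT', hηT, b, hb, hb0⟩ := hd
  have hab : X.presheaf.map (homOfLE hT).op a = b := by
    apply ofUnit_injective (i := i) T
    rw [hb, ← restriction_ofUnit, ha, map_sub]
  have ha0 : a = 0 := by
    apply germ_injective_of_isIntegral X _ hU
    rw [map_zero, ← hb0, ← hab, germ_map_homOfLE]
  rw [← sub_eq_zero, ← ha, ha0, map_zero]

variable [IrreducibleSpace X] {U W : X.Opens} {v : Γ(V, U)} {w : Γ(V, W)}

theorem GenericDiff.restrict_left {k : X.functionField} (h : GenericDiff i v w k) {U' : X.Opens}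
    (hU : U' ≤ U) (hU' : genericPoint X ∈ U') : GenericDiff i (V.restriction hU v) w k := by
  obtain ⟨T, hTU, hTW, hT, a, ha, rfl⟩ := h
  refine ⟨T ⊓ U', inf_le_right, inf_le_left.trans hTW, ⟨hT, hU'⟩,
    X.presheaf.map (homOfLE inf_le_left).op a, ?_, germ_map_homOfLE _ _ _ _⟩
  rw [← restriction_ofUnit, ha, map_sub]
  simp only [restriction_restriction]

theorem GenericDiff.restrict_right {k : X.functionField} (h : GenericDiff i v w k) {W' : X.Opens}
    (hW : W' ≤ W) (hW' : genericPoint X ∈ W') : GenericDiff i v (V.restriction hW w) k := by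
  obtain ⟨T, hTU, hTW, hT, a, ha, rfl⟩ := h
  refine ⟨T ⊓ W', inf_le_left.trans hTU, inf_le_right, ⟨hT, hW'⟩,
    X.presheaf.map (homOfLE inf_le_left).op a, ?_, germ_map_homOfLE _ _ _ _⟩
  rw [← restriction_ofUnit, ha, map_sub]
  simp only [restriction_restriction]

theorem GenericDiff.sub {k k' : X.functionField} {T : X.Opens} {u : Γ(V, T)}
    (h : GenericDiff i v w k) (h' : GenericDiff i u w k') : GenericDiff i v u (k - k') := by
  obtain ⟨A, hAU, hAW, hA, a, ha, rfl⟩ := h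
  obtain ⟨B, hBT, hBW, hB, b, hb, rfl⟩ := h'
  have hAB : genericPoint X ∈ A ⊓ B := ⟨hA, hB⟩
  refine ⟨A ⊓ B, inf_le_left.trans hAU, inf_le_right.trans hBT, hAB,
    X.presheaf.map (homOfLE inf_le_left).op a - X.presheaf.map (homOfLE inf_le_right).op b, ?_, ?_⟩
  · rw [map_sub, ← restriction_ofUnit, ← restriction_ofUnit, ha, hb, map_sub, map_sub]
    simp only [restriction_restriction]
    abel
  · rw [map_sub, germ_map_homOfLE, germ_map_homOfLE]

theorem GenericDiff.sub_ofUnit {k : X.functionField} (h : GenericDiff i v w k)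
    (hU : genericPoint X ∈ U) (b : Γ(X, U)) :
    GenericDiff i (v - ofUnit i U b) w (k - X.presheaf.germ U _ hU b) := by
  obtain ⟨A, hAU, hAW, hA, a, ha, rfl⟩ := h
  refine ⟨A, hAU, hAW, hA, a - X.presheaf.map (homOfLE hAU).op b, ?_, ?_⟩
  · rw [map_sub, ha, map_sub, restriction_ofUnit]
    abel
  · rw [map_sub, germ_map_homOfLE]

end AlgebraicGeometry.Scheme.Modules

namespace AlgebraicGeometry.Scheme.Modules
variable {X : Scheme.{0}} [IsIntegral X] {V : X.Modules} {i : structureSheaf X ⟶ V}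
  {π : V ⟶ structureSheaf X}

/-- If local sections `v x` of `π` differ from a fixed one by functions that are, up to a common
rational function `g`, regular at `x`, then they can be corrected to glue to a splitting. -/
theorem nonempty_splitting_of_genericDiff {w : i ≫ π = 0}
    (hV : (ShortComplex.mk i π w).ShortExact) {Z : Type} {pt : Z → X}
    (hZ : ∀ U : X.Opens, (∀ x, pt x ∈ U) → U = ⊤)
    {W : X.Opens} {v₀ : Γ(V, W)} {U : Z → X.Opens} (hU : ∀ x, pt x ∈ U x) {v : ∀ x, Γ(V, U x)}
    (hv : ∀ x, linearForm π (U x) (v x) = 1) {s : ∀ x : Z, X.presheaf.stalk (pt x)}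
    {g : X.functionField}
    (hd : ∀ x, GenericDiff i (v x) v₀ (algebraMap _ X.functionField (s x) + g)) :
    Nonempty (ShortComplex.mk i π w).Splitting := by
  have := hV.mono_f
  have hi : Mono i := hV.mono_f
  have hB (x : Z) : ∃ (B : X.Opens) (hB : B ≤ U x) (hx : pt x ∈ B) (b : Γ(X, B)),
      X.presheaf.germ B (pt x) hx b = s x := by
    obtain ⟨B, hxB, b, hb⟩ := X.presheaf.exists_germ_eq (s x)
    have hx : pt x ∈ B ⊓ U x := ⟨hxB, hU x⟩
    refine ⟨B ⊓ U x, inf_le_right, hx, X.presheaf.map (homOfLE inf_le_left).op b, ?_⟩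
    exact (germ_map_homOfLE _ _ _ _).trans hb
  choose B hBU hxB b hb using hB
  have hη (x : Z) : genericPoint X ∈ B x :=
    (genericPoint_spec X).specializes trivial |>.mem_open (B x).2 (hxB x)
  let t (x : Z) : Γ(V, B x) := V.restriction (hBU x) (v x) - ofUnit i (B x) (b x)
  have ht (x : Z) : linearForm π (B x) (t x) = 1 := by
    rw [map_sub, linearForm_restriction, hv, linearForm_ofUnit w, map_one, sub_zero]
  have htd (x : Z) : GenericDiff i (t x) v₀ g := by
    have h2 := ((hd x).restrict_left (hBU x) (hη x)).sub_ofUnit (hη x) (b x)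
    have h3 : X.presheaf.germ (B x) _ (hη x) (b x) = algebraMap _ X.functionField (s x) := by
      rw [← hb]
      exact (congr($(X.presheaf.germ_stalkSpecializes (hxB x)
        ((genericPoint_spec X).specializes trivial)) (b x))).symm
    rwa [h3, add_sub_cancel_left] at h2
  have hcompat : TopCat.Presheaf.IsCompatible V.presheaf B t := by
    intro x y
    have hxy : genericPoint X ∈ B x ⊓ B y := ⟨hη x, hη y⟩
    refine eq_of_genericDiff hV hxy (v := V.restriction inf_le_left (t x))
      (v' := V.restriction inf_le_right (t y)) ?_ ?_
    · rw [linearForm_restriction, linearForm_restriction, ht, ht, map_one, map_one]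
    · have := (htd x).sub (htd y)
      rw [sub_self] at this
      exact (this.restrict_left _ hxy).restrict_right _ hxy
  have hcover : (⊤ : X.Opens) ≤ iSup B :=
    (hZ _ fun x ↦ TopologicalSpace.Opens.mem_iSup.mpr ⟨x, hxB x⟩).ge
  obtain ⟨σ, hσ, -⟩ := TopCat.Sheaf.existsUnique_gluing' ⟨V.presheaf, V.isSheaf⟩ B ⊤
    (fun x ↦ homOfLE le_top) hcover t hcompat
  refine nonempty_splitting_of_section hV σ ?_
  refine TopCat.Sheaf.eq_of_locally_eq' X.sheaf B ⊤ (fun x ↦ homOfLE le_top) hcover _ _ fun x ↦ ?_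
  refine (linearForm_restriction π le_top σ).symm.trans ?_
  have : V.restriction (le_top : B x ≤ ⊤) σ = t x := hσ x
  rw [this, ht]
  exact (map_one (X.presheaf.map (homOfLE le_top).op).hom).symm

end AlgebraicGeometry.Scheme.Modules

/-! ### Rational differential forms and cup products -/

theorem rank_kaehlerDifferential_of_isFractionRing {k B K : Type} [Field k] [CommRing B]
    [IsDomain B] [Field K] [Algebra k B] [Algebra k K] [Algebra B K] [IsScalarTower k B K]
    [IsFractionRing B K] (n : ℕ) [Algebra.IsStandardSmoothOfRelativeDimension n k B] :
    Module.rank K (KaehlerDifferential k K) = n := by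
  have := Algebra.IsStandardSmoothOfRelativeDimension.isStandardSmooth n (R := k) (S := B)
  have : Algebra.FormallyEtale B K := .of_isLocalization (nonZeroDivisors B)
  rw [← (KaehlerDifferential.tensorKaehlerEquivOfFormallyEtale k B K).rank_eq,
    Module.rank_baseChange,
    Algebra.IsStandardSmoothOfRelativeDimension.rank_kaehlerDifferential (R := k) (S := B) n]
  simp

namespace SmoothProjectiveCurve

variable (C : SmoothProjectiveCurve)

theorem rank_ratForm : Module.rank C.K C.RatForm = 1 := by
  obtain ⟨U, -, V, hV, hyV, e, h⟩ :=
    SmoothOfRelativeDimension.exists_isStandardSmoothOfRelativeDimension (n := 1) (f := C.str)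
      (genericPoint C.X)
  have : Nonempty V := ⟨⟨_, hyV⟩⟩
  have hU : U = ⊤ := by
    have hs : Subsingleton (Spec (.of ℂ)) := inferInstanceAs (Subsingleton (PrimeSpectrum ℂ))
    ext y
    simp only [TopologicalSpace.Opens.coe_top, Set.mem_univ, iff_true]
    rw [Subsingleton.elim y (C.str (genericPoint C.X))]
    exact e hyV
  subst hU
  let c : ℂ →+* Γ(C.X, V) :=
    (C.str.appLE ⊤ V e).hom.comp (Scheme.ΓSpecIso (.of ℂ)).commRingCatIsoToRingEquiv.symm
  have hc : c.IsStandardSmoothOfRelativeDimension 1 := by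
    have := h.comp (RingHom.IsStandardSmoothOfRelativeDimension.equiv
      (Scheme.ΓSpecIso (.of ℂ)).commRingCatIsoToRingEquiv.symm)
    exact this
  let := c.toAlgebra
  have : Algebra.IsStandardSmoothOfRelativeDimension 1 ℂ Γ(C.X, V) := hc
  have := functionField_isFractionRing_of_isAffineOpen C.X V hV
  have : IsScalarTower ℂ Γ(C.X, V) C.K := by
    apply IsScalarTower.of_algebraMap_eq'
    have h1 : (Scheme.ΓSpecIso (.of ℂ)).inv ≫ C.str.appTop ≫
        C.X.presheaf.germ ⊤ (genericPoint C.X) (TopologicalSpace.Opens.mem_top _) =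
        (Scheme.ΓSpecIso (.of ℂ)).inv ≫ C.str.appLE ⊤ V e ≫
          C.X.presheaf.germ V (genericPoint C.X) hyV := by
      rw [Scheme.Hom.appLE, Category.assoc, TopCat.Presheaf.germ_res]
      rfl
    exact congr($(h1).hom)
  have := rank_kaehlerDifferential_of_isFractionRing (k := ℂ) (B := Γ(C.X, V)) (K := C.K) 1
  simpa using this

variable {C}

/-- An adele is trivial in cohomology if and only if it is the sum of an everywhere regular adele
`b` and a constant one. -/
theorem mk_eq_zero_iff {M : Type} [AddCommGroup M] [Module ℂ M] {L : C.Point → Submodule ℂ M}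
    {a : C.adeles L} : (Submodule.Quotient.mk a : C.H1 L) = 0 ↔
      ∃ (b : C.Point → M) (m : M), (∀ p, b p ∈ L p) ∧ ∀ p, b p + m = a.1 p := by
  rw [Submodule.Quotient.mk_eq_zero]
  constructor
  · intro h
    obtain ⟨b, hb, -, ⟨m, rfl⟩, h⟩ := Submodule.mem_sup.mp h
    exact ⟨b, m, fun p ↦ hb p trivial, congr_fun h⟩
  · rintro ⟨b, m, hb, h⟩
    exact Submodule.mem_sup.mpr ⟨b, fun p _ ↦ hb p, _, ⟨m, rfl⟩, funext h⟩

theorem exists_smul_eq {θ : C.RatForm} (hθ : θ ≠ 0) (ω : C.RatForm) : ∃ g : C.K, g • θ = ω :=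
  (finrank_eq_one_iff_of_nonzero' θ hθ).mp
    (Module.rank_eq_one_iff_finrank_eq_one.mp C.rank_ratForm) ω

/-- Cup product with a nonzero regular form is surjective: an adele of forms may be divided by
`θ`, after setting it to zero where it is regular. -/
theorem cup_surjective {θ : C.globalForms} (hθ : θ ≠ 0) : Function.Surjective (cup θ) := by
  classical
  intro ξ
  obtain ⟨ω, rfl⟩ := Submodule.Quotient.mk_surjective _ ξ
  have hθ' : θ.1 ≠ 0 := fun h ↦ hθ (Subtype.ext h)
  choose g hg using exists_smul_eq hθ'
  let a : C.adeles fun p ↦ C.regularFunctions p.1 :=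
    ⟨fun p ↦ if ω.1 p ∈ C.regularForms p.1 then 0 else g (ω.1 p), ω.2.subset fun p hp h ↦ hp (by
      have h' : ω.1 p ∈ C.regularForms p.1 := h
      simp only [if_pos h']
      exact zero_mem _)⟩
  refine ⟨Submodule.Quotient.mk a, ?_⟩
  refine (Submodule.Quotient.eq _).mpr ?_
  refine Submodule.mem_sup_left fun p _ ↦ ?_
  change (if ω.1 p ∈ C.regularForms p.1 then 0 else g (ω.1 p)) • θ.1 - ω.1 p ∈ C.regularForms p.1
  split_ifs with h
  · rw [zero_smul, zero_sub]
    exact neg_mem h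
  · rw [hg, sub_self]
    exact zero_mem _

/-- The injectivity half of Serre duality for `Ω_C`. -/
theorem serreMap_injective {t : C.H1Ω →ₗ[ℂ] ℂ} (ht : t ≠ 0) {θ : C.globalForms}
    (h : C.serreMap t θ = 0) : θ = 0 := by
  by_contra hθ
  refine ht (LinearMap.ext fun ξ ↦ ?_)
  obtain ⟨a, rfl⟩ := cup_surjective hθ ξ
  exact congr($h a)

theorem cup_zero : cup (0 : C.globalForms) = 0 := by
  ext a
  refine (Submodule.Quotient.mk_eq_zero _).mpr ?_
  have : mulAdele (0 : C.globalForms) a = 0 := Subtype.ext (funext fun p ↦ smul_zero (a.1 p))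
  rw [this]
  exact zero_mem _

/-- A form that vanishes at `x` stays regular there after multiplication by a rational function
with at most a simple pole, i.e. by the inverse of some `t` which generates the maximal ideal. -/
theorem regularForms_of_vanishesAt {η : C.RatForm} {x : C.X} (h : C.VanishesAt η x)
    {t : C.X.presheaf.stalk x} (ht : IsLocalRing.maximalIdeal _ ≤ Ideal.span {t}) {g : C.K}
    (hg : algebraMap _ C.K t * g = 1) : g • η ∈ C.regularForms x := by
  have h1 : η ∈ Ideal.span {t} • C.regularForms x := Submodule.smul_mono_left ht h
  rw [Submodule.ideal_span_singleton_smul] at h1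
  obtain ⟨ω, hω, rfl⟩ := (Submodule.mem_smul_pointwise_iff_exists _ _ _).mp h1
  rw [← algebraMap_smul C.K t ω, smul_smul, mul_comm, hg, one_smul]
  exact hω

theorem eq_top_of_closedPoints (C : SmoothProjectiveCurve) (hC : Nonempty C.Point) (U : C.X.Opens)
    (hU : ∀ p : C.Point, p.1 ∈ U) : U = ⊤ := by
  obtain ⟨p⟩ := hC
  ext x
  simp only [TopologicalSpace.Opens.coe_top, Set.mem_univ, iff_true]
  by_cases hx : x = genericPoint C.X
  · subst hx
    exact ((genericPoint_spec C.X).specializes trivial).mem_open U.2 (hU p)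
  · exact hU ⟨x, C.isClosed_of_ne_genericPoint x hx⟩

end SmoothProjectiveCurve

/-! ### Coordinates on the relative `Proj` -/

namespace AlgebraicGeometry.Scheme

/-- If the closed subscheme `t = 0` of `Spec 𝒪_{X,x}` is nonempty and maps into the reduced point
`r`, then `x = r` and `t` generates the maximal ideal. -/
theorem eq_and_maximalIdeal_le_of_factors {X : Scheme.{0}} {x r : X} (t : X.presheaf.stalk x)
    (ht : ¬ IsUnit t)
    (ℓ : Spec (.of (X.presheaf.stalk x ⧸ Ideal.span {t})) ⟶ Spec (X.residueField r))
    (h : Spec.map (CommRingCat.ofHom (Ideal.Quotient.mk (Ideal.span {t}))) ≫ X.fromSpecStalk x =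
      ℓ ≫ X.fromSpecResidueField r) :
    x = r ∧ IsLocalRing.maximalIdeal (X.presheaf.stalk x) ≤ Ideal.span {t} := by
  have : Nontrivial (X.presheaf.stalk x ⧸ Ideal.span {t}) :=
    Ideal.Quotient.nontrivial_iff.mpr (by rwa [Ne, Ideal.span_singleton_eq_top])
  have hloc : IsLocalHom (Ideal.Quotient.mk (Ideal.span {t})) :=
    .of_surjective _ Ideal.Quotient.mk_surjective
  have : IsLocalRing (X.presheaf.stalk x ⧸ Ideal.span {t}) :=
    .of_surjective' _ Ideal.Quotient.mk_surjective
  have hxr : x = r := by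
    have h1 := congr($h (IsLocalRing.closedPoint _))
    have h2 : Spec.map (CommRingCat.ofHom (Ideal.Quotient.mk (Ideal.span {t})))
        (IsLocalRing.closedPoint (X.presheaf.stalk x ⧸ Ideal.span {t})) =
        IsLocalRing.closedPoint (X.presheaf.stalk x) := IsLocalRing.comap_closedPoint _
    exact (fromSpecStalk_closedPoint.symm.trans (congrArg (X.fromSpecStalk x) h2.symm)).trans
      (h1.trans (fromSpecResidueField_apply r (ℓ _)))
  subst hxr
  refine ⟨rfl, fun m hm ↦ ?_⟩
  obtain ⟨l, rfl⟩ := Spec.map_surjective ℓ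
  rw [fromSpecResidueField, ← Category.assoc, cancel_mono, ← Spec.map_comp] at h
  have h3 := Spec.map_injective h
  rw [← Ideal.Quotient.eq_zero_iff_mem]
  have h4 : Ideal.Quotient.mk (Ideal.span {t}) m = l (X.residue x m) := congr($h3 m)
  have h5 : X.residue x m = 0 := (IsLocalRing.residue_eq_zero_iff m).mpr hm
  rw [h4, h5, map_zero]

end AlgebraicGeometry.Scheme

namespace RelativeProjSym

variable {X S : Scheme.{0}} {V : X.Modules} {ς : S ⟶ X} (P : RelativeProjSym V ς)

/-- The morphism `s : Spec A ⟶ S` factors through the open subset `D₊(x)` of the chart over `U`,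
by means of `φ`. The homogeneous coordinates of `s`, normalized so that `x` becomes `1`, are the
values `φ (m / x)`, for `m ∈ Γ(V, U)`. -/
def IsCoordinate {A : CommRingCat.{0}} (s : Spec A ⟶ S) (U : X.affineOpens)
    {x : SymmetricAlgebra Γ(X, U) Γ(V, U)} (hx : x ∈ grading Γ(X, U) Γ(V, U) 1)
    (φ : Away (grading Γ(X, U) Γ(V, U)) x →+* A) : Prop :=
  s = Spec.map (CommRingCat.ofHom φ) ≫ Proj.awayι _ x hx one_pos ≫ P.chart U

instance (U : X.affineOpens) : Mono U.2.fromSpec :=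
  have : IsOpenImmersion U.2.fromSpec := IsAffineOpen.isOpenImmersion_fromSpec U.2
  inferInstance

instance (U : X.affineOpens) : Mono (P.chart U) := (P.isPullback U).mono_fst_of_mono

variable {P} {A : CommRingCat.{0}} {s : Spec A ⟶ S} {U : X.affineOpens}

/-- A point of `S` over `U` with values in a local ring has coordinates normalized at `v` or at
`w`, if `v` and `w` span `Γ(V, U)`. -/
theorem exists_isCoordinate [IsLocalRing A] (ρ : Γ(X, U) ⟶ A)
    (hs : s ≫ ς = Spec.map ρ ≫ U.2.fromSpec) {v w : Γ(V, U)}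
    (h : Submodule.span Γ(X, U) {v, w} = ⊤) :
    (∃ φ, P.IsCoordinate s U (ι_mem_grading v) φ) ∨
      (∃ φ, P.IsCoordinate s U (ι_mem_grading w) φ) := by
  have hq : (P.isPullback U).lift s (Spec.map ρ) hs ≫ P.chart U = s :=
    (P.isPullback U).lift_fst _ _ _
  refine (exists_lift_of_isLocalRing h ((P.isPullback U).lift s (Spec.map ρ) hs)).imp ?_ ?_ <;>
  · rintro ⟨φ, hφ⟩
    exact ⟨φ, by rw [IsCoordinate, ← Category.assoc, ← hφ, hq]⟩

theorem IsCoordinate.of_isUnit [IsLocalRing A] {v w : Γ(V, U)} {φ}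
    (h : P.IsCoordinate s U (ι_mem_grading v) φ) (hu : IsUnit (φ (fraction (ι_mem_grading v) w))) :
    ∃ ψ, P.IsCoordinate s U (ι_mem_grading w) ψ := by
  obtain ⟨ψ, hψ⟩ := exists_lift_of_isUnit v w φ hu
  refine ⟨ψ, ?_⟩
  rw [IsCoordinate] at h ⊢
  rw [h, ← Category.assoc, hψ, Category.assoc]

theorem IsCoordinate.comp_constHom {x : SymmetricAlgebra Γ(X, U) Γ(V, U)}
    {hx : x ∈ grading Γ(X, U) Γ(V, U) 1} {φ : Away (grading Γ(X, U) Γ(V, U)) x →+* A}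
    (h : P.IsCoordinate s U hx φ) (ρ : Γ(X, U) ⟶ A)
    (hs : s ≫ ς = Spec.map ρ ≫ U.2.fromSpec) : φ.comp (constHom x) = ρ.hom := by
  rw [IsCoordinate] at h
  rw [h, Category.assoc, Category.assoc, (P.isPullback U).w, ← Category.assoc (Proj.awayι _ _ _ _),
    awayι_projSymToSpec, ← Category.assoc, ← Spec.map_comp, cancel_mono] at hs
  exact congr($(Spec.map_injective hs).hom)

theorem IsCoordinate.mul {v w : Γ(V, U)} {φ ψ} (h : P.IsCoordinate s U (ι_mem_grading v) φ)
    (h' : P.IsCoordinate s U (ι_mem_grading w) ψ) (m : Γ(V, U)) :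
    φ (fraction (ι_mem_grading v) w) * ψ (fraction (ι_mem_grading w) m) =
      φ (fraction (ι_mem_grading v) m) := by
  apply fraction_mul_fraction_of_eq
  rw [IsCoordinate] at h h'
  rw [← cancel_mono (P.chart U), Category.assoc, Category.assoc, ← h, ← h']

theorem IsCoordinate.unique {v : Γ(V, U)} {φ ψ} (h : P.IsCoordinate s U (ι_mem_grading v) φ)
    (h' : P.IsCoordinate s U (ι_mem_grading v) ψ) (m : Γ(V, U)) :
    φ (fraction (ι_mem_grading v) m) = ψ (fraction (ι_mem_grading v) m) := by
  rw [← h.mul h' m, fraction_self, map_one, one_mul]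

theorem IsCoordinate.map {x : SymmetricAlgebra Γ(X, U) Γ(V, U)}
    {hx : x ∈ grading Γ(X, U) Γ(V, U) 1} {φ : Away (grading Γ(X, U) Γ(V, U)) x →+* A}
    (h : P.IsCoordinate s U hx φ) {B : CommRingCat.{0}} (χ : A ⟶ B) :
    P.IsCoordinate (Spec.map χ ≫ s) U hx (χ.hom.comp φ) := by
  rw [IsCoordinate] at h ⊢
  rw [h, ← Category.assoc, ← Spec.map_comp]
  rfl

/-- Coordinates over `U` are coordinates over every larger affine open `W`. -/
theorem IsCoordinate.of_le {W : X.affineOpens} (hUW : U ≤ W) {v : Γ(V, W)} {φ}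
    (h : P.IsCoordinate s U (ι_mem_grading (V.restriction hUW v)) φ) :
    ∃ ψ, P.IsCoordinate s W (ι_mem_grading v) ψ ∧ ∀ m, ψ (fraction (ι_mem_grading v) m) =
      φ (fraction (ι_mem_grading (V.restriction hUW v)) (V.restriction hUW m)) := by
  have key (x : SymmetricAlgebra Γ(X, U) Γ(V, U)) (hx : x ∈ grading Γ(X, U) Γ(V, U) 1)
      (φ : Away (grading Γ(X, U) Γ(V, U)) x →+* A) (h : P.IsCoordinate s U hx φ)
      (e : gradedMap (V.restriction hUW) (ι _ _ v) = x) :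
      ∃ ψ, P.IsCoordinate s W (ι_mem_grading v) ψ ∧ ∀ m, ψ (fraction (ι_mem_grading v) m) =
        φ (fraction hx (V.restriction hUW m)) := by
    -- `gradedMap` sends `ι v` to `ι` of the restriction of `v`, but only propositionally so, which
    -- is why the denominator has to be a variable.
    subst e
    refine ⟨φ.comp (Away.map (gradedMap (V.restriction hUW)) (ι _ _ v)), ?_, fun m ↦ ?_⟩
    · rw [IsCoordinate] at h ⊢
      rw [h, P.compatible U W hUW v, ← Category.assoc, ← Spec.map_comp]
      rfl
    · rw [RingHom.comp_apply, awayMap_fraction]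
  exact key _ _ φ h (mapSemilinear_ι _ v)

variable {i : structureSheaf X ⟶ V} {π : V ⟶ structureSheaf X} {w : i ≫ π = 0}

/-- Where `π` has a section `v`, the module of sections of `V` is spanned by `i 1` and `v`. -/
theorem span_eq_top (hV : (ShortComplex.mk i π w).ShortExact) {v : Γ(V, U)}
    (hv : linearForm π U v = 1) : Submodule.span Γ(X, U) {ofUnit i U 1, v} = ⊤ := by
  rw [eq_top_iff]
  rintro m -
  obtain ⟨b, hb⟩ := exists_ofUnit_eq hV (v := m - linearForm π U m • v) (by
    rw [map_sub, _root_.map_smul, hv, smul_eq_mul, mul_one, sub_self])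
  refine Submodule.mem_span_pair.mpr ⟨b, linearForm π U m, ?_⟩
  rw [← _root_.map_smul, smul_eq_mul, mul_one, hb, sub_add_cancel]

/-- In the chart `D₊(v)`, the section of `S` given by `π` is the locus where `i 1 / v` vanishes. -/
theorem IsCoordinate.factors_through_section (hV : (ShortComplex.mk i π w).ShortExact)
    {σ : X ⟶ S} (hσ : P.IsSectionOf π σ) (ρ : Γ(X, U) ⟶ A)
    (hs : s ≫ ς = Spec.map ρ ≫ U.2.fromSpec) {v : Γ(V, U)} (hv : linearForm π U v = 1) {φ}
    (h : P.IsCoordinate s U (ι_mem_grading v) φ)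
    (h0 : φ (fraction (ι_mem_grading v) (ofUnit i U 1)) = 0) : s = (s ≫ ς) ≫ σ := by
  have hc := h.comp_constHom ρ hs
  have hφ : φ = ρ.hom.comp (awayEval (linearForm π U) v hv) :=
    eq_comp_awayEval _ hv (linearForm_ofUnit w U.1 1) (span_eq_top hV hv) hc h0
  rw [IsCoordinate, hφ] at h
  rw [hs, Category.assoc, hσ.eq_on_chart U v hv, h, ← Category.assoc, ← Category.assoc,
    ← Category.assoc, ← Spec.map_comp]
  rfl

end RelativeProjSym

open RelativeProjSym

/-! ### The pullback of the affine coordinate of the ruled surface -/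

namespace NonconstantMap

variable {C E : SmoothProjectiveCurve} (f : NonconstantMap C E)

theorem ne_genericPoint (f : NonconstantMap C E) (r : C.Point) : r.1 ≠ genericPoint C.X := by
  intro h
  refine f.nonconstant ⟨f.hom r.1, fun x ↦ ?_⟩
  have hx : r.1 ⤳ x := h ▸ (genericPoint_spec C.X).specializes trivial
  have : x = r.1 := hx.mem_closed r.2 rfl
  rw [this]

/-- Pullback of functions on `U` to the local ring at a point `x` over `U`. -/
def sectionsToStalk (x : C.X) {U : E.X.Opens} (hx : f.hom x ∈ U) :
    Γ(E.X, U) ⟶ C.X.presheaf.stalk x :=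
  E.X.presheaf.germ U _ hx ≫ f.hom.stalkMap x

theorem pullbackK_germ {U : E.X.Opens} (hU : genericPoint E.X ∈ U)
    (hU' : f.hom (genericPoint C.X) ∈ U) (a : Γ(E.X, U)) :
    f.pullbackK (E.X.presheaf.germ U _ hU a) = f.sectionsToStalk (genericPoint C.X) hU' a := by
  have h : E.X.presheaf.germ U _ hU ≫ E.X.presheaf.stalkSpecializes f.genericPoint_specializes ≫
      f.hom.stalkMap (genericPoint C.X) = f.sectionsToStalk (genericPoint C.X) hU' := by
    rw [TopCat.Presheaf.germ_stalkSpecializes_assoc]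
    rfl
  exact congr($h a)

variable {S : Scheme.{0}} {ς : S ⟶ E.X} {f' : C.X ⟶ S}

theorem fromSpecStalk_comp (hf' : f' ≫ ς = f.hom) (x : C.X) (U : E.X.affineOpens)
    (hx : f.hom x ∈ U.1) : (C.X.fromSpecStalk x ≫ f') ≫ ς =
      Spec.map (f.sectionsToStalk x hx) ≫ U.2.fromSpec := by
  have h : E.X.fromSpecStalk (f.hom x) = Spec.map (E.X.presheaf.germ U.1 _ hx) ≫ U.2.fromSpec :=
    (IsAffineOpen.fromSpecStalk_eq_fromSpecStalk U.2 hx).symm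
  rw [Category.assoc, hf', ← Scheme.SpecMap_stalkMap_fromSpecStalk, h, sectionsToStalk,
    Spec.map_comp, Category.assoc]

variable {V : E.X.Modules} {i : structureSheaf E.X ⟶ V} {π : V ⟶ structureSheaf E.X}
  {w : i ≫ π = 0} {P : RelativeProjSym V ς}

/-- The lift `f'` maps `x` into the locus where the coordinate `i 1` is invertible, unless `x =
r`; at `r` the function `i 1 / v` generates the maximal ideal, because the preimage of the section
is the reduced point `r`. -/
theorem isCoordinate_dichotomy (hV : (ShortComplex.mk i π w).ShortExact) {σ : E.X ⟶ S}
    (hσ : P.IsSectionOf π σ) (hf' : f' ≫ ς = f.hom) {r : C.X}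
    (hr : ∃ e, IsPullback (C.X.fromSpecResidueField r) e f' σ) (x : C.X) (U : E.X.affineOpens)
    (hx : f.hom x ∈ U.1) {v : Γ(V, U)} (hv : linearForm π U v = 1) :
    (∃ φ, P.IsCoordinate (C.X.fromSpecStalk x ≫ f') U (ι_mem_grading (ofUnit i U 1)) φ) ∨
    (∃ φ, P.IsCoordinate (C.X.fromSpecStalk x ≫ f') U (ι_mem_grading v) φ ∧ x = r ∧
      IsLocalRing.maximalIdeal (C.X.presheaf.stalk x) ≤
        Ideal.span {φ (fraction (ι_mem_grading v) (ofUnit i U 1))}) := by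
  have hs := f.fromSpecStalk_comp hf' x U hx
  rcases exists_isCoordinate (P := P) _ hs (span_eq_top hV hv) with h | ⟨φ, hφ⟩
  · exact .inl h
  by_cases hu : IsUnit (φ (fraction (ι_mem_grading v) (ofUnit i U 1)))
  · exact .inl (hφ.of_isUnit hu)
  right
  obtain ⟨e, hp⟩ := hr
  let t := φ (fraction (ι_mem_grading v) (ofUnit i U 1))
  let q : C.X.presheaf.stalk x ⟶ .of (C.X.presheaf.stalk x ⧸ Ideal.span {t}) :=
    CommRingCat.ofHom (Ideal.Quotient.mk (Ideal.span {t}))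
  have hsec := (hφ.map q).factors_through_section hV hσ (f.sectionsToStalk x hx ≫ q)
    (by rw [Category.assoc, hs, Spec.map_comp, Category.assoc]) hv
    (Ideal.Quotient.eq_zero_iff_mem.mpr (Ideal.mem_span_singleton_self t))
  have hsec' : (Spec.map q ≫ C.X.fromSpecStalk x) ≫ f' =
      ((Spec.map q ≫ C.X.fromSpecStalk x ≫ f') ≫ ς) ≫ σ := by
    rw [Category.assoc]
    exact hsec
  refine ⟨φ, hφ, Scheme.eq_and_maximalIdeal_le_of_factors t hu (hp.lift _ _ hsec') ?_⟩
  exact (hp.lift_fst _ _ hsec').symm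

variable (P i f') in
/-- The rational function `g` on `C` is the pullback along `f'` of the function `v / i 1` on `S`. -/
def HasRatio (U : E.X.affineOpens) (v : Γ(V, U)) (g : C.K) : Prop :=
  ∃ φ : Away (grading Γ(E.X, U) Γ(V, U)) (ι _ _ (ofUnit i U 1)) →+*
      C.X.presheaf.stalk (genericPoint C.X),
    P.IsCoordinate (C.X.fromSpecStalk (genericPoint C.X) ≫ f') U (ι_mem_grading (ofUnit i U 1)) φ ∧
      φ (fraction (ι_mem_grading (ofUnit i U 1)) v) = g

/-- For a local section `v` of `π`, the pullback of `v / i 1` is regular away from `r`, and has at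
worst a simple pole at `r`. -/
theorem exists_hasRatio (hV : (ShortComplex.mk i π w).ShortExact) {σ : E.X ⟶ S}
    (hσ : P.IsSectionOf π σ) (hf' : f' ≫ ς = f.hom) {r : C.Point}
    (hr : ∃ e, IsPullback (C.X.fromSpecResidueField r.1) e f' σ) (x : C.X) (U : E.X.affineOpens)
    (hx : f.hom x ∈ U.1) {v : Γ(V, U)} (hv : linearForm π U v = 1) :
    ∃ g, HasRatio f' i P U v g ∧ (g ∈ C.regularFunctions x ∨ x = r.1 ∧
      ∃ t : C.X.presheaf.stalk x, IsLocalRing.maximalIdeal _ ≤ Ideal.span {t} ∧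
        algebraMap _ C.K t * g = 1) := by
  have hη : genericPoint C.X ⤳ x := (genericPoint_spec C.X).specializes trivial
  have hcomp : Spec.map (C.X.presheaf.stalkSpecializes hη) ≫ C.X.fromSpecStalk x ≫ f' =
      C.X.fromSpecStalk (genericPoint C.X) ≫ f' := by
    rw [Scheme.SpecMap_stalkSpecializes_fromSpecStalk_assoc]
  rcases f.isCoordinate_dichotomy hV hσ hf' hr x U hx hv with ⟨φ, hφ⟩ | ⟨φ, hφ, hxr, hm⟩
  · have := hφ.map (C.X.presheaf.stalkSpecializes hη)
    rw [hcomp] at this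
    exact ⟨_, ⟨_, this, rfl⟩, .inl ⟨φ (fraction _ v), rfl⟩⟩
  · have hφη := hφ.map (C.X.presheaf.stalkSpecializes hη)
    rw [hcomp] at hφη
    have hηU : f.hom (genericPoint C.X) ∈ U.1 := (hη.map f.hom.continuous).mem_open U.1.2 hx
    obtain ⟨ψ, hψ⟩ := (f.isCoordinate_dichotomy hV hσ hf' hr _ U hηU hv).resolve_right
      fun ⟨_, _, h, _⟩ ↦ f.ne_genericPoint r h.symm
    refine ⟨_, ⟨ψ, hψ, rfl⟩, .inr ⟨hxr, _, hm, ?_⟩⟩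
    refine (hφη.mul hψ v).trans ?_
    rw [fraction_self, map_one]

/-- If `v - u = i k`, then the pullbacks of `v / i 1` and of `u / i 1` differ by the pullback of
`k`. -/
theorem HasRatio.sub_eq (hV : (ShortComplex.mk i π w).ShortExact) {σ : E.X ⟶ S}
    (hσ : P.IsSectionOf π σ) (hf' : f' ≫ ς = f.hom) {r : C.Point}
    (hr : ∃ e, IsPullback (C.X.fromSpecResidueField r.1) e f' σ) {U W : E.X.affineOpens}
    {v : Γ(V, U)} {u : Γ(V, W)} (hv : linearForm π U v = 1) {g g' k}
    (hg : HasRatio f' i P U v g) (hg' : HasRatio f' i P W u g') (hk : GenericDiff i v u k) :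
    g - g' = f.pullbackK k := by
  obtain ⟨T, hTU, hTW, hηT, a, ha, rfl⟩ := hk
  obtain ⟨_, ⟨B, hB, rfl⟩, hηB, hBT⟩ := E.X.isBasis_affineOpens.exists_subset_of_mem_open hηT T.2
  replace hBT : B ≤ T := hBT
  let B' : E.X.affineOpens := ⟨B, hB⟩
  have hηB' : f.hom (genericPoint C.X) ∈ B := by rw [f.map_genericPoint]; exact hηB
  obtain ⟨-, ⟨φ, hφ, -⟩, -⟩ := f.exists_hasRatio hV hσ hf' hr (genericPoint C.X) B' hηB'
    (v := V.restriction (hBT.trans hTU) v) (by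
      rw [linearForm_restriction]
      exact (congrArg _ hv).trans (map_one _))
  -- Both ratios can be computed in the chart of the smaller affine open `B`.
  have key {U : E.X.affineOpens} (hU : B' ≤ U) {v : Γ(V, U)} {g} (hg : HasRatio f' i P U v g) :
      φ (fraction (ι_mem_grading (ofUnit i B'.1 1)) (V.restriction hU v)) = g := by
    obtain ⟨ψ, hψ, rfl⟩ := hg
    have he : V.restriction hU (ofUnit i U.1 1) = ofUnit i B'.1 1 := by
      rw [restriction_ofUnit, map_one]
    have aux (e : Γ(V, B'.1)) (he : V.restriction hU (ofUnit i U.1 1) = e)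
        (φ : Away (grading Γ(E.X, B'.1) Γ(V, B'.1)) (ι _ _ e) →+*
          C.X.presheaf.stalk (genericPoint C.X))
        (hφ : P.IsCoordinate (C.X.fromSpecStalk (genericPoint C.X) ≫ f') B' (ι_mem_grading e) φ) :
        φ (fraction (ι_mem_grading e) (V.restriction hU v)) =
          ψ (fraction (ι_mem_grading (ofUnit i U.1 1)) v) := by
      subst he
      obtain ⟨χ, hχ, h⟩ := hφ.of_le hU
      rw [← h, hχ.unique hψ]
    exact aux _ he φ hφ
  rw [← key (hBT.trans hTU) hg, ← key (hBT.trans hTW) hg', sub_eq_iff_eq_add]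
  have hvu : V.restriction (hBT.trans hTU) v =
      E.X.presheaf.map (homOfLE hBT).op a • ofUnit i B 1 + V.restriction (hBT.trans hTW) u := by
    rw [← _root_.map_smul, smul_eq_mul, mul_one, ← restriction_ofUnit, ha, map_sub,
      restriction_restriction, restriction_restriction, sub_add_cancel]
  have hc := congr($(hφ.comp_constHom _ (f.fromSpecStalk_comp hf' _ B' hηB'))
    (E.X.presheaf.map (homOfLE hBT).op a))
  rw [hvu, fraction_add, fraction_smul, fraction_self, mul_one, map_add]
  congr 1
  refine hc.trans ?_
  rw [← Scheme.germ_map_homOfLE hBT _ hηB, f.pullbackK_germ hηB hηB']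

end NonconstantMap

/-! ### The extension class -/

/-- The extension class in `H¹(E, 𝒪_E)` of a nonsplit extension, represented by the adele that
compares local sections of `π` with a fixed one, is nonzero. -/
theorem extensionClass_ne_zero {E : SmoothProjectiveCurve} {V : E.X.Modules}
    {i : structureSheaf E.X ⟶ V} {π : V ⟶ structureSheaf E.X}
    {w : i ≫ π = 0} (hV : (ShortComplex.mk i π w).ShortExact)
    (hVsplit : IsEmpty (ShortComplex.mk i π w).Splitting) (hE : Nonempty E.Point)
    {W : E.X.Opens} {v₀ : Γ(V, W)} {U : E.Point → E.X.affineOpens} (hU : ∀ p, p.1 ∈ (U p).1)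
    {v : ∀ p, Γ(V, U p)} (hv : ∀ p, linearForm π (U p) (v p) = 1)
    {a : E.adeles fun p ↦ E.regularFunctions p.1} (ha : ∀ p, GenericDiff i (v p) v₀ (a.1 p)) :
    (Submodule.Quotient.mk a : E.H1O) ≠ 0 := by
  intro h
  obtain ⟨b, g, hb, hbg⟩ := SmoothProjectiveCurve.mk_eq_zero_iff.mp h
  have hb' (p : E.Point) : ∃ s : E.X.presheaf.stalk p.1, algebraMap _ E.K s = b p := hb p
  choose s hs using hb'
  have hd (p : E.Point) : GenericDiff i (v p) v₀ (algebraMap _ E.K (s p) + g) := by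
    rw [hs, hbg]
    exact ha p
  exact not_isEmpty_iff.mpr
    (nonempty_splitting_of_genericDiff hV (E.eq_top_of_closedPoints hE) hU hv hd) hVsplit

/-- The extension class is represented by an adele whose pullback to `C` is the sum of a constant
adele and of an adele `G` that is regular away from `r` and has at worst a simple pole at `r`. -/
theorem NonconstantMap.exists_extensionAdele {C E : SmoothProjectiveCurve} (f : NonconstantMap C E)
    {V : E.X.Modules} {i : structureSheaf E.X ⟶ V} {π : V ⟶ structureSheaf E.X}
    {w : i ≫ π = 0} (hV : (ShortComplex.mk i π w).ShortExact)
    (hVsplit : IsEmpty (ShortComplex.mk i π w).Splitting)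
    {S : Scheme.{0}} {ς : S ⟶ E.X} {P : RelativeProjSym V ς} {σ : E.X ⟶ S}
    (hσ : P.IsSectionOf π σ) {r : C.Point} {f' : C.X ⟶ S} (hf' : f' ≫ ς = f.hom)
    (hr : ∃ e, IsPullback (C.X.fromSpecResidueField r.1) e f' σ) :
    ∃ a : E.adeles fun p ↦ E.regularFunctions p.1,
      (Submodule.Quotient.mk a : E.H1O) ≠ 0 ∧
      ∃ (G : C.Point → C.K) (g₀ : C.K), (∀ p, f.pullbackK (a.1 (f.mapPoint p)) = G p - g₀) ∧
        ∀ p, G p ∈ C.regularFunctions p.1 ∨ p.1 = r.1 ∧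
          ∃ t : C.X.presheaf.stalk p.1, IsLocalRing.maximalIdeal _ ≤ Ideal.span {t} ∧
            algebraMap _ C.K t * G p = 1 := by
  have hπ : Epi π := hV.epi_g
  choose U hU v hv using fun x : E.X ↦ exists_linearForm_eq_one (π := π) x
  have hη (x : E.X) : genericPoint E.X ∈ (U x).1 :=
    ((genericPoint_spec E.X).specializes trivial).mem_open (U x).1.2 (hU x)
  let U₀ := U (genericPoint E.X)
  let v₀ : Γ(V, U₀) := v (genericPoint E.X)
  -- The sections `v p` and `v₀` differ by a function which is regular at `p` for `p ∈ U₀`, hence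
  -- for all but finitely many `p`.
  have hk (p : E.X) : ∃ k : E.K, GenericDiff i (v p) v₀ k ∧
      (p ∈ U₀.1 → k ∈ E.regularFunctions p) := by
    by_cases hp : p ∈ U₀.1
    · obtain ⟨s, hs⟩ := exists_genericDiff hV (hv p) (hv _) p (hU p) hp
      exact ⟨_, hs, fun _ ↦ ⟨s, rfl⟩⟩
    · obtain ⟨s, hs⟩ := exists_genericDiff hV (hv p) (hv _) _ (hη p) (hη _)
      exact ⟨_, hs, fun h ↦ absurd h hp⟩
  choose k hk hkreg using hk
  let a : E.adeles fun p ↦ E.regularFunctions p.1 := ⟨fun p ↦ k p.1, by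
    refine Set.Finite.of_finite_image (f := Subtype.val)
      ((E.finite_of_isClosed (U₀.1 : Set E.X)ᶜ U₀.1.2.isClosed_compl fun h ↦ h (hη _)).subset ?_)
      Subtype.val_injective.injOn
    rintro _ ⟨p, hp, rfl⟩ h
    exact hp (hkreg p.1 h)⟩
  refine ⟨a, extensionClass_ne_zero hV hVsplit ⟨f.mapPoint r⟩ (fun p ↦ hU p.1) (fun p ↦ hv p.1)
    (fun p ↦ hk p.1), ?_⟩
  choose G hG hGreg using fun p : C.Point ↦ f.exists_hasRatio hV hσ hf' hr p.1 (U (f.hom p.1))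
      (hU _) (hv _)
  obtain ⟨g₀, hg₀, -⟩ := f.exists_hasRatio hV hσ hf' hr (genericPoint C.X) U₀
      (by rw [f.map_genericPoint]; exact hη _) (hv _)
  exact ⟨G, g₀, fun p ↦ (HasRatio.sub_eq f hV hσ hf' hr (hv _) (hG p) hg₀ (hk _)).symm, hGreg⟩

end

open Scheme.Modules in
theorem lemma3 (C E : SmoothProjectiveCurve) (hE : E.genus = 1)
    (V : E.X.Modules) (i : structureSheaf E.X ⟶ V) (π : V ⟶ structureSheaf E.X)
    (hiπ : i ≫ π = 0) (hV : (ShortComplex.mk i π hiπ).ShortExact)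
    (hVsplit : IsEmpty (ShortComplex.mk i π hiπ).Splitting)
    (S : Scheme.{0}) (ς : S ⟶ E.X) (P : RelativeProjSym V ς)
    (σ : E.X ⟶ S) (hσ : P.IsSectionOf π σ)
    (r : C.Point) (f : NonconstantMap C E)
    (f' : C.X ⟶ S) (hf' : f' ≫ ς = f.hom)
    (hr : ∃ e, IsPullback (C.X.fromSpecResidueField r.1) e f' σ) :
    f.IsQuasiTraceless r := by
  intro tC tE _ htE η hη θ
  obtain ⟨a, ha, G, g₀, hG, hGreg⟩ := f.exists_extensionAdele hV hVsplit hσ hf' hr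
  -- The form `η` kills the pole of `G` at `r`, so `η` times the pullback of `a` is the sum of the
  -- regular adele `G • η` and a constant one.
  have hzero : SmoothProjectiveCurve.cup η (f.pullbackH1 (Submodule.Quotient.mk a)) = 0 := by
    refine SmoothProjectiveCurve.mk_eq_zero_iff.mpr
      ⟨fun p ↦ G p • η.1, (-g₀) • η.1, fun p ↦ ?_, fun p ↦ ?_⟩
    · rcases hGreg p with h | ⟨hp, t, ht, htG⟩
      · exact SmoothProjectiveCurve.smul_mem_regularForms h ((Submodule.mem_iInf _).mp η.2 p.1)
      · exact SmoothProjectiveCurve.regularForms_of_vanishesAt (hp ▸ hη) ht htG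
    · change G p • η.1 + (-g₀) • η.1 = f.pullbackK (a.1 (f.mapPoint p)) • η.1
      rw [hG, sub_eq_add_neg, add_smul]
  -- As `H¹(E, 𝒪_E)` is a line, it is spanned by the extension class.
  have hcomp : C.serreMap tC η ∘ₗ f.pullbackH1 = 0 := by
    ext ξ
    obtain ⟨c, hc⟩ := (finrank_eq_one_iff_of_nonzero' _ ha).mp hE (Submodule.Quotient.mk ξ)
    change tC (SmoothProjectiveCurve.cup η (f.pullbackH1 (Submodule.Quotient.mk ξ))) = 0
    rw [← hc, _root_.map_smul, _root_.map_smul, hzero, smul_zero, map_zero]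
  rw [NonconstantMap.IsTrace, hcomp]
  refine ⟨SmoothProjectiveCurve.serreMap_injective htE, ?_⟩
  rintro rfl
  rw [SmoothProjectiveCurve.serreMap, SmoothProjectiveCurve.cup_zero, LinearMap.comp_zero]
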